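/- Let $K$ be a compact connected metric space which is the invariant set of finitely many contractive similarities $F_1,\dots,F_N:K\to K$ (i.e. $K=\bigcup_i F_i(K)$), and suppose that this self-similar structure is post-critically finite with boundary $V_0=\{q_0,q_1,q_2\}$ consisting of exactly three points. (Here $V_0$ is the set of points of $K$ having a post-critical address.) For a word $w=w_1\cdots w_m$ put $F_w=F_{w_1}\circ\cdots\circ F_{w_m}$, $C_w=F_w(K)$ (a cell of level $m$), and let $D_w$ be the union of $C_w$ and its neighboring cells, i.e. of all cells of level $m$ that meet $C_w$. Let $(D,r)$ be a regular harmonic structure on $K$: $D$ is a symmetric non-positive definite $3\times3$ matrix with non-negative off-diagonal entries whose kernel consists of the constants, $0<r_i<1$ for all $i$, and, with $r_w=r_{w_1}\cdots r_{w_m}$ and $\mathcal E_m(u)=\sum_{|w|=m} r_w^{-1}\,\mathcal E_0(u\circ F_w|_{V_0})$, $\mathcal E_0(f)=-{}^t\!f D f$, one has $\mathcal E_0(f)=\min\{\mathcal E_1(u): u|_{V_0}=f\}$ for all $f:V_0\to\mathbb R$. Put $\mathcal E(u)=\lim_m\mathcal E_m(u)\in[0,\infty]$. Let $\mu$ be a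 self-similar Borel probability measure on $K$, $\mu=\sum_i \mu_i\,(F_i)_*\mu$ with $\mu_i>0$, $\sum_i\mu_i=1$. Assume full $D_3$ symmetry: there is a group $\mathcal G\cong D_3$ of homeomorphisms of $K$ which acts on $V_0$ by permutations, realizing every permutation of $V_0$, and whose elements preserve the harmonic structure (the matrix $D$ on $V_0$, and $\mathcal E(u\circ g)=\mathcal E(u)$ for continuous $u$) and the measure $\mu$. Assume also $r_1=\cdots=r_N$ and $\mu_1=\cdots=\mu_N$. A continuous function $h:K\to\mathbb R$ is called harmonic if, for every $m$ and every point $p\notin V_0$ of the form $p=F_w(q_j)$ with $|w|=m$, $$\sum_{|v|=m,\ F_v(q_i)=p} r_v^{-1}\sum_{k} D_{ik}\,h(F_v(q_k))=0 .$$ A mean value neighborhood of $x\in K$ associated to a cell $C_w$ is a Borel neighborhood $B$ of $x$ with $C_w\subset B\subset D_w$ and $$\frac1{\mu(B)}\int_B h\,d\mu=h(x)\quad\text{for every harmonic function } h .$$ Theorem. (a) For every $x\in K\setminus V_0$ and every cell $C_w$ containing $x$ and disjoint from $V_0$, there is a mean value neighborhood $B$ of $x$ associated to $C_w$; in particular $C_w\subset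 B\subset D_w$. (b) For every $x\in K\setminus V_0$ there are $k_0$ and sets $B_k(x)$, $k\ge k_0$, such that each $B_k(x)$ is a mean value neighborhood of $x$ associated to a cell of level $k$ which contains $x$ and is disjoint from $V_0$, the sets $B_k(x)$ form a neighborhood basis of $x$, and $\bigcap_{k\ge k_0}B_k(x)=\{x\}$. -/

import Mathlib

open Set Filter Topology MeasureTheory
open scoped Matrix ENNReal NNReal

noncomputable section

namespace PCF

/-- A compact metric space `K` (for example the invariant set of an iterated function system in a
Euclidean space, with the induced metric) presented as the invariant set of `N` contractive
similarities `F_i : K → K`, that is `K = ⋃ i, F_i(K)`. -/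
structure SimilarityIFS (K : Type*) [MetricSpace K] (N : ℕ) where
  /-- the maps `F_i` -/
  map : Fin N → K → K
  /-- the contraction ratios -/
  ratio : Fin N → ℝ
  ratio_pos : ∀ i, 0 < ratio i
  ratio_lt_one : ∀ i, ratio i < 1
  dist_map : ∀ i x y, dist (map i x) (map i y) = ratio i * dist x y
  iUnion_range : ⋃ i, range (map i) = univ

variable {K : Type*} [MetricSpace K] {N : ℕ}

namespace SimilarityIFS

/-- `F_w = F_{w_1} ∘ ⋯ ∘ F_{w_m}` for a word `w = w_1 ⋯ w_m` of length `m`. -/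
def wordMap (S : SimilarityIFS K N) : (m : ℕ) → (Fin m → Fin N) → K → K
  | 0, _ => id
  | m + 1, w => S.map (w 0) ∘ S.wordMap m (fun i => w i.succ)

/-- The cell `C_w = F_w(K)`, of level `m`. -/
def cell (S : SimilarityIFS K N) {m : ℕ} (w : Fin m → Fin N) : Set K :=
  range (S.wordMap m w)

/-- `D_w`: the union of `C_w` and its neighbouring cells, which are the cells of the same level
that meet `C_w`. -/
def cellNbhd (S : SimilarityIFS K N) {m : ℕ} (w : Fin m → Fin N) : Set K :=
  ⋃ (v : Fin m → Fin N) (_ : (S.cell v ∩ S.cell w).Nonempty), S.cell v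

/-- The infinite word `ω` is an address of `x`, i.e. `π(ω) = x` where
`{π(ω)} = ⋂ m, F_{ω_1 ⋯ ω_m}(K)`. -/
def IsAddress (S : SimilarityIFS K N) (ω : ℕ → Fin N) (x : K) : Prop :=
  ∀ m : ℕ, x ∈ S.cell (fun i : Fin m => ω i)

/-- The critical set `π⁻¹(⋃_{i ≠ j} F_i(K) ∩ F_j(K))`. -/
def criticalSet (S : SimilarityIFS K N) : Set (ℕ → Fin N) :=
  {ω | ∃ x, S.IsAddress ω x ∧ ∃ i j, i ≠ j ∧ x ∈ range (S.map i) ∩ range (S.map j)}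

/-- The post-critical set: all the `n`-fold left shifts, `n ≥ 1`, of critical words. -/
def postCriticalSet (S : SimilarityIFS K N) : Set (ℕ → Fin N) :=
  {τ | ∃ ω ∈ S.criticalSet, ∃ n : ℕ, 1 ≤ n ∧ τ = fun k => ω (k + n)}

/-- Post-critically finite. -/
def IsPCF (S : SimilarityIFS K N) : Prop :=
  S.postCriticalSet.Finite

/-- The boundary `V_0`: the points with a post-critical address. -/
def boundary (S : SimilarityIFS K N) : Set K :=
  {x | ∃ ω ∈ S.postCriticalSet, S.IsAddress ω x}

/-- The renormalized graph energy of level `m`,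
`𝓔_m(u) = ∑_{|w| = m} r_w⁻¹ 𝓔_0(u ∘ F_w)`, where `𝓔_0(f) = - ᵗf D f` is the form of `D` on
`V_0 = {q 0, q 1, q 2}` and `r_w = r_{w_1} ⋯ r_{w_m}`. -/
def graphEnergy (S : SimilarityIFS K N) (q : Fin 3 → K) (D : Matrix (Fin 3) (Fin 3) ℝ)
    (r : Fin N → ℝ) (m : ℕ) (u : K → ℝ) : ℝ :=
  ∑ w : Fin m → Fin N, (∏ i, r (w i))⁻¹ *
    -((fun k => u (S.wordMap m w (q k))) ⬝ᵥ (D *ᵥ fun k => u (S.wordMap m w (q k))))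

/-- The energy `𝓔(u) = lim_m 𝓔_m(u) ∈ [0, ∞]`; for a harmonic structure `𝓔_m(u)` is non-negative
and non-decreasing in `m`, so that the limit is the supremum. -/
def energy (S : SimilarityIFS K N) (q : Fin 3 → K) (D : Matrix (Fin 3) (Fin 3) ℝ)
    (r : Fin N → ℝ) (u : K → ℝ) : ℝ≥0∞ :=
  ⨆ m : ℕ, ENNReal.ofReal (S.graphEnergy q D r m u)

open Classical in
/-- The discrete Laplacian `H_m u` of level `m` at the point `p`, associated with `𝓔_m`: the sum,
over the pairs `(w, j)` with `|w| = m` and `F_w(q_j) = p`, of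
`r_w⁻¹ (D (u ∘ F_w))(q_j) = r_w⁻¹ ∑_k D_{jk} u(F_w(q_k))`. -/
def graphLaplacian (S : SimilarityIFS K N) (q : Fin 3 → K) (D : Matrix (Fin 3) (Fin 3) ℝ)
    (r : Fin N → ℝ) (m : ℕ) (u : K → ℝ) (p : K) : ℝ :=
  ∑ w : Fin m → Fin N, ∑ j : Fin 3,
    if S.wordMap m w (q j) = p then
      (∏ i, r (w i))⁻¹ * (D *ᵥ fun k => u (S.wordMap m w (q k))) j
    else 0

/-- `h` is harmonic on `K`: it is continuous and `H_m h = 0` at all points of `V_m ∖ V_0`, for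
all `m` (where `V_m` is the set of all `F_w(q_j)` with `|w| = m`). -/
def IsHarmonic (S : SimilarityIFS K N) (q : Fin 3 → K) (D : Matrix (Fin 3) (Fin 3) ℝ)
    (r : Fin N → ℝ) (h : K → ℝ) : Prop :=
  Continuous h ∧
    ∀ (m : ℕ) (w : Fin m → Fin N) (j : Fin 3), S.wordMap m w (q j) ∉ S.boundary →
      S.graphLaplacian q D r m h (S.wordMap m w (q j)) = 0

end SimilarityIFS

/-- `D` is a Laplacian on a three point set: symmetric, non-positive definite, with kernel the
constants, and with non-negative off-diagonal entries. -/
structure IsLaplacian (D : Matrix (Fin 3) (Fin 3) ℝ) : Prop where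
  symm : D.IsSymm
  nonpos : ∀ f : Fin 3 → ℝ, f ⬝ᵥ (D *ᵥ f) ≤ 0
  ker : ∀ f : Fin 3 → ℝ, D *ᵥ f = 0 ↔ ∃ c : ℝ, f = fun _ => c
  offDiag_nonneg : ∀ i j, i ≠ j → 0 ≤ D i j

/-- `(D, r)` is a regular harmonic structure: `D` is a Laplacian on `V_0 = {q 0, q 1, q 2}`,
`0 < r_i < 1`, and the energy `𝓔_0` is the trace of `𝓔_1` on `V_0`, that is
`𝓔_0(f) = min {𝓔_1(u) : u = f on V_0}`. -/
structure IsRegularHarmonicStructure (S : SimilarityIFS K N) (q : Fin 3 → K)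
    (D : Matrix (Fin 3) (Fin 3) ℝ) (r : Fin N → ℝ) : Prop where
  isLaplacian : IsLaplacian D
  pos : ∀ i, 0 < r i
  lt_one : ∀ i, r i < 1
  compatible : ∀ f : Fin 3 → ℝ,
    IsLeast (S.graphEnergy q D r 1 '' {u : K → ℝ | ∀ i, u (q i) = f i}) (-(f ⬝ᵥ (D *ᵥ f)))

/-- `μ` is the self-similar probability measure with weights `ν_i`: `μ = ∑ i, ν_i (F_i)_* μ`. -/
structure IsSelfSimilarMeasure [MeasurableSpace K] (S : SimilarityIFS K N) (ν : Fin N → ℝ≥0)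
    (μ : Measure K) : Prop where
  isProbabilityMeasure : IsProbabilityMeasure μ
  weight_pos : ∀ i, 0 < ν i
  sum_weight : ∑ i, ν i = 1
  self_similar : μ = ∑ i, (ν i : ℝ≥0∞) • μ.map (S.map i)

/-- Full `D_3` symmetry: there is a group `G ≅ D_3` of homeomorphisms of `K` which acts on
`V_0 = {q 0, q 1, q 2}` by permutations (all of which occur), and whose elements preserve the
harmonic structure (the matrix `D` on `V_0` and the energy on `K`) and the measure. -/
def HasFullD3Symmetry [MeasurableSpace K] (S : SimilarityIFS K N) (q : Fin 3 → K)
    (D : Matrix (Fin 3) (Fin 3) ℝ) (r : Fin N → ℝ) (μ : Measure K) : Prop :=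
  ∃ G : Subgroup (K ≃ₜ K),
    Nonempty (G ≃* DihedralGroup 3) ∧
    (∀ g ∈ G,
      (∃ σ : Equiv.Perm (Fin 3), (∀ i, g (q i) = q (σ i)) ∧ ∀ i j, D (σ i) (σ j) = D i j) ∧
      (∀ u : K → ℝ, Continuous u → S.energy q D r (fun x => u (g x)) = S.energy q D r u) ∧
      MeasurePreserving g μ μ) ∧
    ∀ σ : Equiv.Perm (Fin 3), ∃ g ∈ G, ∀ i, g (q i) = q (σ i)

/-- `B` is a mean value neighbourhood of `x` associated to the cell `C_w`, of level `m = |w|`: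
a measurable neighbourhood of `x` with `C_w ⊆ B ⊆ D_w` such that every harmonic function has mean
value `h(x)` over `B`. -/
structure IsMeanValueNbhd [MeasurableSpace K] (S : SimilarityIFS K N) (q : Fin 3 → K)
    (D : Matrix (Fin 3) (Fin 3) ℝ) (r : Fin N → ℝ) (μ : Measure K) (x : K)
    {m : ℕ} (w : Fin m → Fin N) (B : Set K) : Prop where
  measurableSet : MeasurableSet B
  mem_nhds : B ∈ 𝓝 x
  cell_subset : S.cell w ⊆ B
  subset_cellNbhd : B ⊆ S.cellNbhd w
  mean_value : ∀ h : K → ℝ, S.IsHarmonic q D r h → ⨍ y in B, h y ∂μ = h x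

end PCF

end

/-! Full symmetry makes `D` a positive multiple of the complete graph Laplacian. Harmonic functions
are the continuous functions whose energy is no larger than that of their boundary values, so `h ∘
g` is harmonic whenever `h` is and `g` is a symmetry. For the rotation `g`, the sum `h + h ∘ g + h ∘
g ∘ g` is constant on `V_0`, hence on `K` by the maximum principle. Integrating it shows that over
any invariant set `h` has the same mean, that of its three boundary values
(`IsHarmonic.setIntegral_of_invariant`).

Let `p_i` be the vertices of `C_w`, and `M_i` the number of cells of the same level that contain
`p_i`. With equal `r`, harmonicity at `p_i` says that the vertex means of `h` over these cells add
up to `M_i h(p_i)`. Copy disjoint invariant sets `E_i` of measure `e_i` into every cell containing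
`p_i`, and let `B` be the union of `C_w` with these copies. Then the integral of `h` over `B` is
`μ(C_w)` times `(1 - ∑ e_i) A + ∑ e_i M_i h(p_i)`, where `A` is the vertex mean on `C_w`
(`IsHarmonic.setIntegral_enlargedCell`).

On the other side, `h(x) = ∑ b_i h(p_i)` with convex weights that do not depend on `h`
(`exists_barycentric`). The two expressions become proportional for suitable `e_i`
(`exists_weights`), and sets with these measures exist because `μ` has no atoms. If `x` is not a
vertex of `C_w`, no other cell of that level contains it, so `C_w` is already a neighbourhood; if it
is one, `B` is the union of all cells containing `x`. Part (b) follows since the diameters of cells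
tend to `0`. -/

namespace PCF.SimilarityIFS

/-! ### Cells, addresses and the boundary. -/

variable {K : Type*} [MetricSpace K] {N : ℕ} (S : SimilarityIFS K N)

theorem map_injective (i : Fin N) : Function.Injective (S.map i) := by
  intro x y h
  have h1 := S.dist_map i x y
  rw [h, dist_self] at h1
  have := S.ratio_pos i
  rcases mul_eq_zero.1 h1.symm with h2 | h2
  · exact absurd h2 this.ne'
  · exact dist_eq_zero.1 h2

theorem wordMap_succ {m : ℕ} (w : Fin (m + 1) → Fin N) (x : K) :
    S.wordMap (m + 1) w x = S.map (w 0) (S.wordMap m (fun i => w i.succ) x) := rfl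

@[simp]
theorem wordMap_cons {m : ℕ} (i : Fin N) (w : Fin m → Fin N) (x : K) :
    S.wordMap (m + 1) (Fin.cons i w) x = S.map i (S.wordMap m w x) := by
  simp [wordMap_succ]

theorem wordMap_injective {m : ℕ} (w : Fin m → Fin N) : Function.Injective (S.wordMap m w) := by
  induction m with
  | zero => exact Function.injective_id
  | succ m ih => exact (S.map_injective _).comp (ih _)

theorem dist_wordMap {m : ℕ} (w : Fin m → Fin N) (x y : K) :
    dist (S.wordMap m w x) (S.wordMap m w y) = (∏ i, S.ratio (w i)) * dist x y := by
  induction m with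
  | zero => simp [wordMap]
  | succ m ih => rw [wordMap_succ, wordMap_succ, S.dist_map, ih, Fin.prod_univ_succ, mul_assoc]

theorem continuous_wordMap {m : ℕ} (w : Fin m → Fin N) : Continuous (S.wordMap m w) := by
  have hp : 0 ≤ ∏ i, S.ratio (w i) := Finset.prod_nonneg fun i _ => (S.ratio_pos _).le
  exact (LipschitzWith.of_dist_le_mul (K := ⟨_, hp⟩) fun x y =>
    (S.dist_wordMap w x y).le).continuous

theorem continuous_map (i : Fin N) : Continuous (S.map i) :=
  S.continuous_wordMap (m := 1) (fun _ => i)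

theorem isClosed_cell [CompactSpace K] {m : ℕ} (w : Fin m → Fin N) : IsClosed (S.cell w) :=
  (isCompact_range (S.continuous_wordMap w)).isClosed

theorem exists_map_eq (x : K) : ∃ i y, S.map i y = x := by
  have h : x ∈ ⋃ i, range (S.map i) := by rw [S.iUnion_range]; trivial
  simpa using h

theorem exists_isAddress (x : K) : ∃ ω, S.IsAddress ω x := by
  choose i y h using S.exists_map_eq
  have key : ∀ (m : ℕ) (x : K),
      S.wordMap m (fun k : Fin m => i (y^[k] x)) (y^[m] x) = x := by
    intro m
    induction m with
    | zero => intro x; rfl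
    | succ m ih =>
      intro x
      rw [wordMap_succ]
      have := ih (y x)
      simp only [Fin.val_zero, Fin.val_succ, Function.iterate_succ_apply,
        Function.iterate_zero, id] at this ⊢
      rw [this, h]
  exact ⟨fun k => i (y^[k] x), fun m => ⟨_, key m x⟩⟩

theorem exists_mem_cell (m : ℕ) (x : K) : ∃ w : Fin m → Fin N, x ∈ S.cell w := by
  obtain ⟨ω, h⟩ := S.exists_isAddress x
  exact ⟨_, h m⟩

theorem isAddress_map_iff {ω : ℕ → Fin N} {x : K} :
    S.IsAddress ω (S.map (ω 0) x) ↔ S.IsAddress (fun k => ω (k + 1)) x := by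
  constructor
  · intro h m
    obtain ⟨y, hy⟩ := h (m + 1)
    exact ⟨y, S.map_injective _ hy⟩
  · intro h m
    cases m with
    | zero => exact ⟨_, rfl⟩
    | succ m =>
      obtain ⟨y, hy⟩ := h m
      exact ⟨y, congrArg (S.map (ω 0)) hy⟩

theorem exists_isAddress_map (i : Fin N) {η : ℕ → Fin N} {x : K} (h : S.IsAddress η x) :
    ∃ ω, S.IsAddress ω (S.map i x) ∧ ω 0 = i ∧ (fun k => ω (k + 1)) = η := by
  let ω : ℕ → Fin N := fun k => Nat.casesOn k i η
  exact ⟨ω, (S.isAddress_map_iff (ω := ω)).2 h, rfl, rfl⟩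

variable {S}

/-- Prepending `i` to an address of `x` gives a critical word, and one shift recovers the address.
-/
theorem mem_boundary_of_map_mem_inter {i j k : Fin N} {x : K} (hjk : j ≠ k)
    (hj : S.map i x ∈ range (S.map j)) (hk : S.map i x ∈ range (S.map k)) : x ∈ S.boundary := by
  obtain ⟨η, hη⟩ := S.exists_isAddress x
  obtain ⟨ω, h1, -, h3⟩ := S.exists_isAddress_map i hη
  exact ⟨η, ⟨ω, ⟨_, h1, j, k, hjk, hj, hk⟩, 1, le_rfl, h3.symm⟩, hη⟩

theorem mem_boundary_of_map_mem {i : Fin N} {x : K} (h : S.map i x ∈ S.boundary) :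
    x ∈ S.boundary := by
  obtain ⟨τ, hτ, ha⟩ := h
  by_cases hi : τ 0 = i
  · subst hi
    obtain ⟨ω, hω, n, hn, rfl⟩ := hτ
    refine ⟨_, ⟨ω, hω, n + 1, by omega, rfl⟩, ?_⟩
    have := S.isAddress_map_iff.1 ha
    convert this using 2 with k
    congr 1; ring
  · obtain ⟨y, hy⟩ := ha 1
    exact mem_boundary_of_map_mem_inter (Ne.symm hi) ⟨x, rfl⟩ ⟨y, hy⟩

theorem mem_boundary_of_wordMap_mem {m : ℕ} {w : Fin m → Fin N} {x : K}
    (h : S.wordMap m w x ∈ S.boundary) : x ∈ S.boundary := by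
  induction m with
  | zero => exact h
  | succ m ih => exact ih (mem_boundary_of_map_mem h)

/-- At the first letter where the words differ, the common point lies in two cells of level one; the
remaining letters only shift its address. Thus distinct cells of one level meet only in vertices. -/
theorem mem_boundary_of_wordMap_eq {m : ℕ} {v w : Fin m → Fin N} (hvw : v ≠ w) {x y : K}
    (h : S.wordMap m v x = S.wordMap m w y) : x ∈ S.boundary := by
  induction m with
  | zero => exact absurd (Subsingleton.elim v w) hvw
  | succ m ih =>
    rw [wordMap_succ, wordMap_succ] at h
    by_cases h0 : v 0 = w 0
    · rw [h0] at h
      refine ih (fun h1 => hvw ?_) (S.map_injective _ h)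
      funext k
      exact Fin.cases h0 (fun k => congrFun h1 k) k
    · exact mem_boundary_of_wordMap_mem
        (mem_boundary_of_map_mem_inter h0 ⟨_, rfl⟩ ⟨_, h.symm⟩)

theorem exists_ne_of_boundary_nonempty (h : S.boundary.Nonempty) : ∃ i j : Fin N, i ≠ j := by
  obtain ⟨_, _, ⟨_, ⟨_, _, i, j, hij, _⟩, _⟩, _⟩ := h
  exact ⟨i, j, hij⟩

/-- The cells of level `m` that contain `x` together form a neighbourhood of `x`. -/
theorem biUnion_cell_mem_nhds [CompactSpace K] (m : ℕ) (x : K) :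
    (⋃ (v : Fin m → Fin N) (_ : x ∈ S.cell v), S.cell v) ∈ 𝓝 x := by
  have hc : IsClosed (⋃ v ∈ {v : Fin m → Fin N | x ∉ S.cell v}, S.cell v) :=
    Set.Finite.isClosed_biUnion (Set.toFinite _) fun v _ => S.isClosed_cell v
  have hx : (⋃ v ∈ {v : Fin m → Fin N | x ∉ S.cell v}, S.cell v)ᶜ ∈ 𝓝 x := by
    refine hc.isOpen_compl.mem_nhds ?_
    simp
  refine Filter.mem_of_superset hx fun y hy => ?_
  obtain ⟨v, hv⟩ := S.exists_mem_cell m y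
  refine mem_iUnion₂.2 ⟨v, ?_, hv⟩
  by_contra h
  exact hy (mem_iUnion₂.2 ⟨v, h, hv⟩)

theorem exists_dist_le_of_mem_cell [CompactSpace K] (S : SimilarityIFS K N) {ε : ℝ} (hε : 0 < ε) :
    ∃ n : ℕ, ∀ m, n ≤ m → ∀ w : Fin m → Fin N, ∀ x ∈ S.cell w, ∀ y ∈ S.cell w, dist x y < ε := by
  obtain ⟨ρ, hρ0, hρ1, hρ⟩ : ∃ ρ : ℝ, 0 ≤ ρ ∧ ρ < 1 ∧ ∀ i, S.ratio i ≤ ρ := by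
    rcases isEmpty_or_nonempty (Fin N) with hN | hN
    · exact ⟨0, le_rfl, one_pos, fun i => (hN.false i).elim⟩
    · obtain ⟨i, hi⟩ := Finite.exists_max S.ratio
      exact ⟨S.ratio i, (S.ratio_pos i).le, S.ratio_lt_one i, hi⟩
  have hb : Bornology.IsBounded (univ : Set K) := isCompact_univ.isBounded
  have hlim : Tendsto (fun m : ℕ => ρ ^ m * Metric.diam (univ : Set K)) atTop (𝓝 0) := by
    simpa using (tendsto_pow_atTop_nhds_zero_of_lt_one hρ0 hρ1).mul_const
      (Metric.diam (univ : Set K))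
  obtain ⟨n, hn⟩ := eventually_atTop.1 (hlim.eventually (gt_mem_nhds hε))
  refine ⟨n, fun m hm w => ?_⟩
  rintro _ ⟨x, rfl⟩ _ ⟨y, rfl⟩
  rw [dist_wordMap]
  refine lt_of_le_of_lt ?_ (hn m hm)
  refine mul_le_mul ?_ (Metric.dist_le_diam_of_mem hb trivial trivial) dist_nonneg (by positivity)
  calc ∏ i, S.ratio (w i) ≤ ∏ _i : Fin m, ρ :=
        Finset.prod_le_prod (fun i _ => (S.ratio_pos _).le) fun i _ => hρ _
    _ = ρ ^ m := by simp

variable {q : Fin 3 → K} (hqV : range q = S.boundary)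
include hqV

theorem apply_mem_boundary (j : Fin 3) : q j ∈ S.boundary := hqV ▸ mem_range_self j

theorem exists_eq_of_mem_boundary {x : K} (hx : x ∈ S.boundary) : ∃ j, q j = x := by
  rwa [← hqV] at hx

theorem exists_wordMap_eq_of_mem_boundary {m : ℕ} {w : Fin m → Fin N} {x : K}
    (hx : x ∈ S.boundary) (hw : x ∈ S.cell w) : ∃ j, S.wordMap m w (q j) = x := by
  obtain ⟨y, rfl⟩ := hw
  obtain ⟨j, rfl⟩ := exists_eq_of_mem_boundary hqV (mem_boundary_of_wordMap_mem hx)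
  exact ⟨j, rfl⟩

theorem exists_wordMap_eq_of_mem_cell {m : ℕ} {v w : Fin m → Fin N} (hvw : v ≠ w) {x : K}
    (hv : x ∈ S.cell v) (hw : x ∈ S.cell w) : ∃ j, S.wordMap m v (q j) = x := by
  obtain ⟨y, rfl⟩ := hv
  obtain ⟨z, hz⟩ := hw
  obtain ⟨j, rfl⟩ := exists_eq_of_mem_boundary hqV (mem_boundary_of_wordMap_eq hvw hz.symm)
  exact ⟨j, rfl⟩

end PCF.SimilarityIFS

/-! ### The symmetric Laplacian, graph energies and restriction of harmonic functions. -/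

namespace PCF

/-- The quadratic forms of a `3 × 3` Laplacian which is invariant under all permutations: a multiple
of the complete graph Laplacian. -/
theorem IsLaplacian.exists_mulVec_eq {D : Matrix (Fin 3) (Fin 3) ℝ} (hD : IsLaplacian D)
    (hσ : ∀ (σ : Equiv.Perm (Fin 3)) (i j : Fin 3), D (σ i) (σ j) = D i j) :
    ∃ c : ℝ, 0 < c ∧ ∀ f j, (D *ᵥ f) j = c * (∑ k, f k - 3 * f j) := by
  have h1 := (hD.ker fun _ => 1).2 ⟨1, rfl⟩
  have hrow : ∀ i, D i 0 + D i 1 + D i 2 = 0 := by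
    intro i
    simpa [Matrix.mulVec, dotProduct, Fin.sum_univ_three] using congrFun h1 i
  have a1 : D 0 2 = D 0 1 := hσ (Equiv.swap 1 2) 0 1
  have a2 : D 1 0 = D 0 1 := hσ (Equiv.swap 0 1) 0 1
  have a3 : D 2 1 = D 0 1 := hσ (Equiv.swap 0 2) 0 1
  have a4 : D 1 2 = D 0 2 := hσ (Equiv.swap 0 1) 0 2
  have a5 : D 2 0 = D 1 0 := hσ (Equiv.swap 1 2) 1 0
  have h0 := hrow 0
  have h1 := hrow 1
  have h2 := hrow 2
  have key : ∀ f j, (D *ᵥ f) j = D 0 1 * (∑ k, f k - 3 * f j) := by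
    intro f j
    fin_cases j <;> simp [Matrix.mulVec, dotProduct, Fin.sum_univ_three]
    · linear_combination h0 * f 0 + a1 * (f 2 - f 0)
    · linear_combination h1 * f 1 + (a4 + a1) * (f 2 - f 1) + a2 * (f 0 - f 1)
    · linear_combination h2 * f 2 + (a5 + a2) * (f 0 - f 2) + a3 * (f 1 - f 2)
  refine ⟨D 0 1, lt_of_le_of_ne (hD.offDiag_nonneg 0 1 (by decide)) fun hz => ?_, key⟩
  obtain ⟨b, hb⟩ := (hD.ker ![0, 1, 0]).1 (by funext j; rw [key, ← hz]; simp)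
  have e0 := congrFun hb 0
  have e1 := congrFun hb 1
  simp at e0 e1
  linarith

namespace SimilarityIFS

variable {K : Type*} [MetricSpace K] {N : ℕ} {S : SimilarityIFS K N} {q : Fin 3 → K}
  {D : Matrix (Fin 3) (Fin 3) ℝ} {r : Fin N → ℝ}

theorem sum_words_succ {M : Type*} [AddCommMonoid M] {m : ℕ} (f : (Fin (m + 1) → Fin N) → M) :
    ∑ w, f w = ∑ i, ∑ w : Fin m → Fin N, f (Fin.cons i w) := by
  rw [← Fintype.sum_prod_type']
  exact (Fintype.sum_equiv (Fin.consEquiv fun _ => Fin N) _ _ fun _ => rfl).symm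

variable (S q D r) in
/-- The bilinear form `𝓔_m(u, v)` of the graph energy. -/
noncomputable def graphForm (m : ℕ) (u v : K → ℝ) : ℝ :=
  ∑ w : Fin m → Fin N, (∏ i, r (w i))⁻¹ *
    -((fun k => u (S.wordMap m w (q k))) ⬝ᵥ (D *ᵥ fun k => v (S.wordMap m w (q k))))

theorem graphEnergy_zero (u : K → ℝ) :
    S.graphEnergy q D r 0 u = -((fun k => u (q k)) ⬝ᵥ (D *ᵥ fun k => u (q k))) := by
  simp [graphEnergy, wordMap]

theorem graphEnergy_succ (m : ℕ) (u : K → ℝ) :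
    S.graphEnergy q D r (m + 1) u
      = ∑ i, (r i)⁻¹ * S.graphEnergy q D r m (fun x => u (S.map i x)) := by
  rw [graphEnergy, sum_words_succ]
  refine Finset.sum_congr rfl fun i _ => ?_
  rw [graphEnergy, Finset.mul_sum]
  refine Finset.sum_congr rfl fun w _ => ?_
  simp only [wordMap_cons, Fin.prod_univ_succ, Fin.cons_zero, Fin.cons_succ, mul_inv]
  ring

/-- Summation by parts. `P` need only contain the vertices where `v` is nonzero, so it serves both
for all of `V_m` and for a single vertex. -/
theorem graphForm_eq_neg_sum (m : ℕ) (v u : K → ℝ) {P : Finset K}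
    (hP : ∀ (w : Fin m → Fin N) (j : Fin 3), v (S.wordMap m w (q j)) ≠ 0 →
      S.wordMap m w (q j) ∈ P) :
    S.graphForm q D r m v u = -∑ p ∈ P, v p * S.graphLaplacian q D r m u p := by
  simp only [graphForm, graphLaplacian, dotProduct, Finset.mul_sum]
  rw [Finset.sum_comm, ← Finset.sum_neg_distrib]
  refine Finset.sum_congr rfl fun w _ => ?_
  rw [Finset.sum_comm, mul_neg, neg_inj, Finset.mul_sum]
  refine Finset.sum_congr rfl fun j _ => ?_
  by_cases h : v (S.wordMap m w (q j)) = 0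
  · rw [h, zero_mul, mul_zero]
    refine (Finset.sum_eq_zero fun p _ => ?_).symm
    split_ifs with hp
    · rw [← hp, h, zero_mul]
    · rw [mul_zero]
  · rw [Finset.sum_eq_single_of_mem _ (hP w j h), if_pos rfl]
    · ring
    · intro p _ hp
      rw [if_neg (Ne.symm hp), mul_zero]

theorem IsHarmonic.add {u v : K → ℝ} (hu : S.IsHarmonic q D r u) (hv : S.IsHarmonic q D r v) :
    S.IsHarmonic q D r (fun x => u x + v x) := by
  refine ⟨hu.1.add hv.1, fun m w j h => ?_⟩
  rw [← add_zero (0 : ℝ)]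
  nth_rewrite 1 [← hu.2 m w j h]
  rw [← hv.2 m w j h]
  simp only [graphLaplacian, ← Finset.sum_add_distrib]
  refine Finset.sum_congr rfl fun w _ => Finset.sum_congr rfl fun j _ => ?_
  split_ifs
  · rw [← mul_add, ← Pi.add_apply, ← Matrix.mulVec_add]
    rfl
  · simp

theorem IsHarmonic.const_mul {u : K → ℝ} (hu : S.IsHarmonic q D r u) (a : ℝ) :
    S.IsHarmonic q D r (fun x => a * u x) := by
  refine ⟨hu.1.const_mul a, fun m w j h => ?_⟩
  rw [← mul_zero a, ← hu.2 m w j h]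
  simp only [graphLaplacian, Finset.mul_sum]
  refine Finset.sum_congr rfl fun w _ => Finset.sum_congr rfl fun j _ => ?_
  split_ifs
  · have : (fun k => a * u (S.wordMap m w (q k))) = a • fun k => u (S.wordMap m w (q k)) := rfl
    rw [this, Matrix.mulVec_smul, Pi.smul_apply, smul_eq_mul]
    ring
  · simp

/-- For `p` outside the boundary, `F_i(p)` lies in no other cell of level one, so the equation of
level `m + 1` at `F_i(p)` is `(r i)⁻¹` times that of level `m` at `p`. -/
theorem IsHarmonic.comp_map {h : K → ℝ} (hh : S.IsHarmonic q D r h) (hr : ∀ i, 0 < r i)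
    (i : Fin N) : S.IsHarmonic q D r (fun x => h (S.map i x)) := by
  refine ⟨hh.1.comp (S.continuous_map i), fun m w j hp => ?_⟩
  have h1 := hh.2 (m + 1) (Fin.cons i w) j
  rw [wordMap_cons] at h1
  specialize h1 fun h => hp (mem_boundary_of_map_mem h)
  rw [graphLaplacian, sum_words_succ, Finset.sum_eq_single_of_mem i (Finset.mem_univ i)] at h1
  · refine (mul_eq_zero.1 (?_ : (r i)⁻¹ * _ = 0)).resolve_left (inv_ne_zero (hr i).ne')
    rw [← h1, graphLaplacian]
    simp only [Finset.mul_sum]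
    refine Finset.sum_congr rfl fun v _ => Finset.sum_congr rfl fun k _ => ?_
    have hiff : S.wordMap (m + 1) (Fin.cons i v) (q k) = S.map i (S.wordMap m w (q j)) ↔
        S.wordMap m v (q k) = S.wordMap m w (q j) := by
      rw [wordMap_cons, (S.map_injective i).eq_iff]
    by_cases hv : S.wordMap m v (q k) = S.wordMap m w (q j)
    · rw [if_pos hv, if_pos (hiff.2 hv)]
      simp only [wordMap_cons, Fin.prod_univ_succ, Fin.cons_zero, Fin.cons_succ, mul_inv]
      ring
    · rw [if_neg hv, if_neg fun h => hv (hiff.1 h), mul_zero]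
  · intro i' _ hi'
    refine Finset.sum_eq_zero fun v _ => Finset.sum_eq_zero fun k _ => if_neg fun h => hp ?_
    rw [wordMap_cons] at h
    exact mem_boundary_of_map_mem_inter hi' ⟨_, h⟩ ⟨_, rfl⟩

theorem IsHarmonic.comp_wordMap {h : K → ℝ} (hh : S.IsHarmonic q D r h) (hr : ∀ i, 0 < r i)
    {m : ℕ} (w : Fin m → Fin N) : S.IsHarmonic q D r (fun x => h (S.wordMap m w x)) := by
  induction m generalizing h with
  | zero => exact hh
  | succ m ih => exact ih (hh.comp_map hr (w 0)) _

theorem IsHarmonic.graphForm_eq_zero {h v : K → ℝ} (hh : S.IsHarmonic q D r h)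
    (hv : ∀ x ∈ S.boundary, v x = 0) (m : ℕ) : S.graphForm q D r m v h = 0 := by
  classical
  rw [graphForm_eq_neg_sum m v h
    (P := (Finset.univ : Finset ((Fin m → Fin N) × Fin 3)).image
      fun p => S.wordMap m p.1 (q p.2))
    fun w j _ => Finset.mem_image.2 ⟨(w, j), Finset.mem_univ _, rfl⟩]
  rw [neg_eq_zero]
  refine Finset.sum_eq_zero fun p hp => ?_
  obtain ⟨⟨w, j⟩, -, rfl⟩ := Finset.mem_image.1 hp
  by_cases hb : S.wordMap m w (q j) ∈ S.boundary
  · rw [hv _ hb, zero_mul]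
  · rw [hh.2 m w j hb, mul_zero]

section CompleteGraph

variable {c : ℝ} (hDc : ∀ f j, (D *ᵥ f) j = c * (∑ k, f k - 3 * f j))
include hDc

theorem dotProduct_mulVec_eq (f g : Fin 3 → ℝ) :
    -(f ⬝ᵥ (D *ᵥ g)) = c * ((f 0 - f 1) * (g 0 - g 1) + (f 1 - f 2) * (g 1 - g 2)
      + (f 2 - f 0) * (g 2 - g 0)) := by
  simp only [dotProduct, hDc, Fin.sum_univ_three]
  ring

theorem isHarmonic_const (a : ℝ) : S.IsHarmonic q D r (fun _ => a) := by
  refine ⟨continuous_const, fun m w j _ => ?_⟩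
  refine Finset.sum_eq_zero fun v _ => Finset.sum_eq_zero fun k _ => ?_
  rw [hDc]
  simp

theorem graphEnergy_add_mul (m : ℕ) (u v : K → ℝ) (t : ℝ) :
    S.graphEnergy q D r m (fun x => u x + t * v x) = S.graphEnergy q D r m u
      + 2 * t * S.graphForm q D r m v u + t ^ 2 * S.graphEnergy q D r m v := by
  simp only [graphEnergy, graphForm, Finset.mul_sum, ← Finset.sum_add_distrib,
    dotProduct_mulVec_eq hDc]
  refine Finset.sum_congr rfl fun w _ => ?_
  ring

theorem graphEnergy_nonneg (hc : 0 ≤ c) (hr : ∀ i, 0 < r i) (m : ℕ) (u : K → ℝ) :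
    0 ≤ S.graphEnergy q D r m u := by
  refine Finset.sum_nonneg fun w _ => ?_
  rw [dotProduct_mulVec_eq hDc]
  have : 0 ≤ (∏ i, r (w i))⁻¹ := inv_nonneg.2 (Finset.prod_nonneg fun i _ => (hr _).le)
  exact mul_nonneg this (mul_nonneg hc
    (add_nonneg (add_nonneg (mul_self_nonneg _) (mul_self_nonneg _)) (mul_self_nonneg _)))

end CompleteGraph

/-! ### The maximum principle. -/

section Connected

variable [CompactSpace K] [ConnectedSpace K]

/-- Cells with different values of `v` cannot meet, since they would share a vertex. The cells with
a given value therefore have clopen union, and `K` is connected. -/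
theorem eq_of_forall_const_on_cell (hqV : range q = S.boundary) {m : ℕ} {v : K → ℝ}
    (hv : ∀ (w : Fin m → Fin N) (j : Fin 3), v (S.wordMap m w (q j)) = v (S.wordMap m w (q 0)))
    (w w' : Fin m → Fin N) : v (S.wordMap m w' (q 0)) = v (S.wordMap m w (q 0)) := by
  set a := v (S.wordMap m w (q 0))
  have hcl : ∀ P : (Fin m → Fin N) → Prop, IsClosed (⋃ u ∈ {u | P u}, S.cell u) := fun P =>
    Set.Finite.isClosed_biUnion (Set.toFinite _) fun u _ => S.isClosed_cell u
  set A := ⋃ u ∈ {u : Fin m → Fin N | v (S.wordMap m u (q 0)) = a}, S.cell u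
  have hmem : ∀ u : Fin m → Fin N, ∀ x ∈ S.cell u, x ∈ A → v (S.wordMap m u (q 0)) = a := by
    intro u x hx hA
    obtain ⟨u', hu', hx'⟩ := mem_iUnion₂.1 hA
    by_cases huu : u = u'
    · rw [huu]; exact hu'
    · obtain ⟨j, hj⟩ := exists_wordMap_eq_of_mem_cell hqV huu hx hx'
      obtain ⟨j', hj'⟩ := exists_wordMap_eq_of_mem_cell hqV (Ne.symm huu) hx' hx
      rw [← hv u j, hj, ← hj', hv u' j']
      exact hu'
  have hA : Aᶜ = ⋃ u ∈ {u : Fin m → Fin N | v (S.wordMap m u (q 0)) ≠ a}, S.cell u := by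
    ext x
    constructor
    · intro hx
      obtain ⟨u, hu⟩ := S.exists_mem_cell m x
      exact mem_iUnion₂.2 ⟨u, fun h => hx (mem_iUnion₂.2 ⟨u, h, hu⟩), hu⟩
    · intro hx hxA
      obtain ⟨u, hu, hxu⟩ := mem_iUnion₂.1 hx
      exact hu (hmem u x hxu hxA)
  have hclopen : IsClopen A := ⟨hcl _, isClosed_compl_iff.1 (hA ▸ hcl _)⟩
  have huniv : A = univ :=
    hclopen.eq_univ ⟨S.wordMap m w (q 0), mem_iUnion₂.2 ⟨w, rfl, ⟨_, rfl⟩⟩⟩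
  exact hmem w' (S.wordMap m w' (q 0)) ⟨_, rfl⟩ (huniv ▸ mem_univ _)

/-- Testing harmonicity against the truncation `v = (h - M)⁺`, which vanishes on `V_0`, bounds the
energy of `v` by zero. So `v` vanishes on every `V_m`, and by density and continuity on `K`. -/
theorem IsHarmonic.le_of_forall_le {c : ℝ} (hc : 0 < c)
    (hDc : ∀ f j, (D *ᵥ f) j = c * (∑ k, f k - 3 * f j)) (hr : ∀ i, 0 < r i)
    (hqV : range q = S.boundary) {h : K → ℝ} (hh : S.IsHarmonic q D r h) {M : ℝ}
    (hM : ∀ i, h (q i) ≤ M) (x : K) : h x ≤ M := by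
  set v : K → ℝ := fun x => max (h x - M) 0 with hvdef
  have hv0 : ∀ x ∈ S.boundary, v x = 0 := by
    intro x hx
    obtain ⟨j, rfl⟩ := exists_eq_of_mem_boundary hqV hx
    exact max_eq_right (sub_nonpos.2 (hM j))
  -- The positive part is monotone and 1-Lipschitz.
  have hmax : ∀ a b : ℝ, (max a 0 - max b 0) ^ 2 ≤ (max a 0 - max b 0) * (a - b) := by
    intro a b
    rcases le_total a 0 with ha | ha <;> rcases le_total b 0 with hb | hb <;>
      simp only [ha, hb, max_eq_left, max_eq_right] <;> nlinarith
  have hmax' : ∀ x y : K, (v x - v y) ^ 2 ≤ (v x - v y) * (h x - h y) := by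
    intro x y
    have := hmax (h x - M) (h y - M)
    rwa [sub_sub_sub_cancel_right] at this
  have hconst : ∀ (m : ℕ) (w : Fin m → Fin N) (j : Fin 3),
      v (S.wordMap m w (q j)) = v (S.wordMap m w (q 0)) := by
    intro m w
    have hz := hh.graphForm_eq_zero hv0 m
    have hR : ∀ w : Fin m → Fin N, 0 < (∏ i, r (w i))⁻¹ := fun w =>
      inv_pos.2 (Finset.prod_pos fun i _ => hr _)
    simp only [graphForm, dotProduct_mulVec_eq hDc] at hz
    rw [Finset.sum_eq_zero_iff_of_nonneg] at hz
    · have hw := hz w (Finset.mem_univ w)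
      have h1 := (mul_eq_zero.1 ((mul_eq_zero.1 hw).resolve_left (hR w).ne')).resolve_left hc.ne'
      set p := fun k => S.wordMap m w (q k) with hp
      change (v (p 0) - v (p 1)) * (h (p 0) - h (p 1)) + (v (p 1) - v (p 2)) * (h (p 1) - h (p 2))
        + (v (p 2) - v (p 0)) * (h (p 2) - h (p 0)) = 0 at h1
      have e1 := hmax' (p 0) (p 1)
      have e2 := hmax' (p 1) (p 2)
      have e3 := hmax' (p 2) (p 0)
      have f1 : (v (p 0) - v (p 1)) ^ 2 = 0 := by
        nlinarith [sq_nonneg (v (p 0) - v (p 1)), sq_nonneg (v (p 1) - v (p 2)),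
          sq_nonneg (v (p 2) - v (p 0))]
      have f2 : (v (p 2) - v (p 0)) ^ 2 = 0 := by
        nlinarith [sq_nonneg (v (p 0) - v (p 1)), sq_nonneg (v (p 1) - v (p 2)),
          sq_nonneg (v (p 2) - v (p 0))]
      have g1 := pow_eq_zero_iff (two_ne_zero) |>.1 f1
      have g2 := pow_eq_zero_iff (two_ne_zero) |>.1 f2
      intro j
      change v (p j) = v (p 0)
      fin_cases j
      · rfl
      · exact (sub_eq_zero.1 g1).symm
      · exact sub_eq_zero.1 g2
    · intro w _
      refine mul_nonneg (hR w).le (mul_nonneg hc.le ?_)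
      refine add_nonneg (add_nonneg ?_ ?_) ?_ <;> exact (sq_nonneg _).trans (hmax' _ _)
  have hzero : ∀ (m : ℕ) (w : Fin m → Fin N), v (S.wordMap m w (q 0)) = 0 := by
    intro m w
    have hq0 := apply_mem_boundary hqV 0
    obtain ⟨w', hw'⟩ := S.exists_mem_cell m (q 0)
    obtain ⟨j, hj⟩ := exists_wordMap_eq_of_mem_boundary hqV hq0 hw'
    rw [eq_of_forall_const_on_cell hqV (hconst m) w' w, ← hconst m w' j, hj, hv0 _ hq0]
  have hvc : Continuous v := (hh.1.sub continuous_const).max continuous_const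
  have hvx : v x = 0 := by
    by_contra hne
    obtain ⟨ε, hε, hball⟩ := Metric.mem_nhds_iff.1 ((hvc.tendsto x).eventually_ne hne)
    obtain ⟨n, hn⟩ := S.exists_dist_le_of_mem_cell hε
    obtain ⟨w, hw⟩ := S.exists_mem_cell n x
    exact hball (hn n le_rfl w _ ⟨q 0, rfl⟩ x hw) (hzero n w)
  have := le_max_left (h x - M) 0
  rw [hvdef] at hvx
  simp only at hvx
  linarith

theorem IsHarmonic.eq_of_forall_eq {c : ℝ} (hc : 0 < c)
    (hDc : ∀ f j, (D *ᵥ f) j = c * (∑ k, f k - 3 * f j)) (hr : ∀ i, 0 < r i)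
    (hqV : range q = S.boundary) {h : K → ℝ} (hh : S.IsHarmonic q D r h) {a : ℝ}
    (ha : ∀ i, h (q i) = a) (x : K) : h x = a := by
  refine le_antisymm (hh.le_of_forall_le hc hDc hr hqV (fun i => (ha i).le) x) ?_
  have := (hh.const_mul (-1)).le_of_forall_le hc hDc hr hqV (M := -a)
    (fun i => by rw [ha i]; linarith) x
  linarith

end Connected

/-! ### Harmonicity as energy minimality, and its invariance under symmetries. -/

section Energy

variable (hD : IsRegularHarmonicStructure S q D r)
include hD

theorem graphEnergy_zero_le (m : ℕ) (u : K → ℝ) :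
    S.graphEnergy q D r 0 u ≤ S.graphEnergy q D r m u := by
  induction m generalizing u with
  | zero => exact le_rfl
  | succ m ih =>
    have h1 : S.graphEnergy q D r 0 u ≤ S.graphEnergy q D r 1 u := by
      rw [graphEnergy_zero]
      exact (hD.compatible fun k => u (q k)).2 ⟨u, fun _ => rfl, rfl⟩
    refine h1.trans ?_
    rw [graphEnergy_succ, graphEnergy_succ]
    exact Finset.sum_le_sum fun i _ =>
      mul_le_mul_of_nonneg_left (ih _) (inv_nonneg.2 (hD.pos i).le)

variable {c : ℝ} (hc : 0 < c) (hDc : ∀ f j, (D *ᵥ f) j = c * (∑ k, f k - 3 * f j))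
  (hqV : range q = S.boundary)
include hc hDc hqV

/-- On level one the minimizer differs from `h` by a function vanishing on `V_0`, so the cross term
is zero and `h` is minimal too. Higher levels follow by restriction to cells. -/
theorem IsHarmonic.graphEnergy_eq {h : K → ℝ} (hh : S.IsHarmonic q D r h) (m : ℕ) :
    S.graphEnergy q D r m h = S.graphEnergy q D r 0 h := by
  have h1 : ∀ {h : K → ℝ}, S.IsHarmonic q D r h →
      S.graphEnergy q D r 1 h = S.graphEnergy q D r 0 h := by
    intro h hh
    refine le_antisymm ?_ (graphEnergy_zero_le hD 1 h)
    obtain ⟨u, hu, hE⟩ := (hD.compatible fun k => h (q k)).1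
    rw [graphEnergy_zero, ← hE]
    have h2 := graphEnergy_add_mul (S := S) (q := q) (r := r) hDc 1 h (fun x => u x - h x) 1
    rw [hh.graphForm_eq_zero (fun x hx => ?_)] at h2
    · have h3 := graphEnergy_nonneg (S := S) (q := q) hDc hc.le hD.pos 1 (fun x => u x - h x)
      have h4 : (fun x => h x + 1 * (u x - h x)) = u := by funext x; ring
      rw [h4] at h2
      linarith
    · obtain ⟨j, rfl⟩ := exists_eq_of_mem_boundary hqV hx
      exact sub_eq_zero.2 (hu j)
  induction m generalizing h with
  | zero => rfl
  | succ m ih =>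
    rw [← h1 hh, graphEnergy_succ, graphEnergy_succ]
    exact Finset.sum_congr rfl fun i _ => by rw [ih (hh.comp_map hD.pos i)]

/-- First variation of `𝓔_m` under a bump at the single vertex `p`. The bump need not be continuous,
as only graph energies enter. -/
theorem isHarmonic_of_energy_le {u : K → ℝ} (hu : Continuous u)
    (hE : S.energy q D r u ≤ ENNReal.ofReal (S.graphEnergy q D r 0 u)) :
    S.IsHarmonic q D r u := by
  classical
  refine ⟨hu, fun m w j hp => ?_⟩
  set p := S.wordMap m w (q j)
  have hle : S.graphEnergy q D r m u ≤ S.graphEnergy q D r 0 u := by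
    have := (le_iSup (fun m => ENNReal.ofReal (S.graphEnergy q D r m u)) m).trans hE
    exact (ENNReal.ofReal_le_ofReal_iff (graphEnergy_nonneg hDc hc.le hD.pos 0 u)).1 this
  set v : K → ℝ := fun x => if x = p then 1 else 0 with hv
  have hF : S.graphForm q D r m v u = -S.graphLaplacian q D r m u p := by
    rw [graphForm_eq_neg_sum (P := {p}) m v u, Finset.sum_singleton]
    · simp [hv]
    · intro w' j' h
      by_contra hne
      exact h (if_neg fun h => hne (Finset.mem_singleton.2 h))
  have hA := graphEnergy_nonneg (S := S) (q := q) hDc hc.le hD.pos m v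
  set A := S.graphEnergy q D r m v
  set F := S.graphForm q D r m v u with hFdef
  have hmin : ∀ t : ℝ, 0 ≤ 2 * t * F + t ^ 2 * A := by
    intro t
    have h1 := graphEnergy_add_mul (S := S) (q := q) (r := r) hDc m u v t
    have h2 := graphEnergy_zero_le hD m (fun x => u x + t * v x)
    have h3 : S.graphEnergy q D r 0 (fun x => u x + t * v x) = S.graphEnergy q D r 0 u := by
      have : ∀ k, v (q k) = 0 := by
        intro k
        have hne : q k ≠ p := fun h => hp (h ▸ apply_mem_boundary hqV k)
        simp [hv, hne]
      simp only [graphEnergy_zero, this, mul_zero, add_zero]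
    linarith
  -- A near-optimal `t`; the denominator `A + 1` avoids treating `A = 0` apart.
  have h1 := hmin (-F / (A + 1))
  have h2 : 2 * (-F / (A + 1)) * F + (-F / (A + 1)) ^ 2 * A
      = -(F ^ 2 * (A + 2)) / (A + 1) ^ 2 := by
    field_simp
    ring
  rw [h2, neg_div] at h1
  have h3 : F ^ 2 * (A + 2) / (A + 1) ^ 2 = 0 := le_antisymm (by linarith) (by positivity)
  have h4 : F = 0 := by
    rcases div_eq_zero_iff.1 h3 with h | h
    · exact pow_eq_zero_iff two_ne_zero |>.1 ((mul_eq_zero.1 h).resolve_right (by linarith))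
    · exact absurd h (by positivity)
  linarith

/-- `𝓔(h ∘ g) = 𝓔(h) = 𝓔_0(h) = 𝓔_0(h ∘ g)`, the last because the complete graph form ignores the
order of the vertices. -/
theorem IsHarmonic.comp_of_energy_eq {g : K → K} (hg : Continuous g)
    (hgE : ∀ u : K → ℝ, Continuous u → S.energy q D r (fun x => u (g x)) = S.energy q D r u)
    {σ : Equiv.Perm (Fin 3)} (hσ : ∀ i, g (q i) = q (σ i)) {h : K → ℝ}
    (hh : S.IsHarmonic q D r h) : S.IsHarmonic q D r (fun x => h (g x)) := by
  refine isHarmonic_of_energy_le hD hc hDc hqV (hh.1.comp hg) ?_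
  rw [hgE h hh.1]
  refine iSup_le fun m => ENNReal.ofReal_le_ofReal ?_
  rw [hh.graphEnergy_eq hD hc hDc hqV, graphEnergy_zero, graphEnergy_zero]
  simp only [hσ, dotProduct, hDc]
  rw [Equiv.sum_comp σ (fun k => h (q k)),
    Equiv.sum_comp σ (fun j => h (q j) * (c * (∑ k, h (q k) - 3 * h (q j))))]

end Energy

end SimilarityIFS

end PCF

/-! ### Invariant sets of prescribed measure, absence of atoms, and means over invariant sets. -/

namespace PCF

/-- In a standard Borel space, a null-singleton measure takes all intermediate values on the
measurable sets which are invariant under a finite group. -/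
theorem exists_invariant_subset_measureReal_eq {K : Type*} [MeasurableSpace K]
    [StandardBorelSpace K] {G : Type*} [Group G] [Finite G] [MulAction G K]
    (hG : ∀ g : G, Measurable fun x : K => g • x) (μ : Measure K) [IsFiniteMeasure μ]
    [NullSingletonClass μ] {A : Set K} (hA : MeasurableSet A)
    (hAG : ∀ (g : G) (x : K), g • x ∈ A ↔ x ∈ A) {t : ℝ} (ht0 : 0 ≤ t) (htA : t ≤ μ.real A) :
    ∃ E ⊆ A, MeasurableSet E ∧ (∀ (g : G) (x : K), g • x ∈ E ↔ x ∈ E) ∧ μ.real E = t := by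
  set φ := embeddingReal K
  have hφ : MeasurableEmbedding φ := measurableEmbedding_embeddingReal K
  -- The minimum of an injective Borel function over the orbit is invariant and has finite, hence
  -- null, fibres. Its distribution function on `A` is therefore continuous, and sublevel sets take
  -- every intermediate measure.
  set f : K → ℝ := fun x => ⨅ g : G, φ (g • x) with hf
  have hfm : Measurable f := Measurable.iInf fun g => hφ.measurable.comp (hG g)
  have hfG : ∀ (g : G) (x : K), f (g • x) = f x := by
    intro g x
    simp only [hf, ← mul_smul]
    exact (Equiv.mulRight g).iInf_congr fun _ => rfl
  have hfib : ∀ s : ℝ, μ (f ⁻¹' {s}) = 0 := by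
    intro s
    have hsub : f ⁻¹' {s} ⊆ ⋃ g : G, {x | φ (g • x) = s} := by
      intro x hx
      obtain ⟨g, hg⟩ := exists_eq_ciInf_of_finite (f := fun g : G => φ (g • x))
      exact mem_iUnion.2 ⟨g, hg.trans hx⟩
    refine measure_mono_null hsub (measure_iUnion_null fun g => ?_)
    refine Set.Subsingleton.measure_zero (fun x hx y hy => ?_) μ
    exact MulAction.injective g (hφ.injective (hx.trans hy.symm))
  set m : Measure ℝ := (μ.restrict A).map f with hm
  have hmI : ∀ s, m (Iic s) = μ (f ⁻¹' Iic s ∩ A) := fun s => by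
    rw [hm, Measure.map_apply hfm measurableSet_Iic,
      Measure.restrict_apply (hfm measurableSet_Iic)]
  have : NullSingletonClass m := ⟨fun s => by
    rw [hm, Measure.map_apply hfm (measurableSet_singleton s),
      Measure.restrict_apply (hfm (measurableSet_singleton s))]
    exact measure_mono_null inter_subset_left (hfib s)⟩
  rcases ht0.eq_or_lt with h0 | h0
  · exact ⟨∅, empty_subset _, MeasurableSet.empty, fun _ _ => Iff.rfl, by simp [h0]⟩
  rcases htA.eq_or_lt with h1 | h1
  · exact ⟨A, Subset.rfl, hA, hAG, h1.symm⟩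
  have hlim : ∀ (l : Filter ℝ) [l.IsCountablyGenerated] (B : Set ℝ), MeasurableSet B →
      (∀ᵐ x ∂m, ∀ᶠ s in l, x ∈ Iic s ↔ x ∈ B) →
      Tendsto (fun s => m.real (Iic s)) l (𝓝 (m.real B)) := fun l _ B hB h =>
    (ENNReal.tendsto_toReal (measure_ne_top _ _)).comp
      (tendsto_measure_of_ae_tendsto_indicator_of_isFiniteMeasure l hB
        (fun _ => measurableSet_Iic) h)
  have hcont : Continuous fun s => m.real (Iic s) := by
    refine continuous_iff_continuousAt.2 fun s => hlim _ _ measurableSet_Iic ?_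
    filter_upwards [Measure.ae_ne m s] with x hx
    rcases lt_or_gt_of_ne hx with h | h
    · filter_upwards [eventually_gt_nhds h] with s' hs'
      exact iff_of_true hs'.le h.le
    · filter_upwards [eventually_lt_nhds h] with s' hs'
      exact iff_of_false (not_le.2 hs') (not_le.2 h)
  have hbot : Tendsto (fun s => m.real (Iic s)) atBot (𝓝 0) := by
    rw [← measureReal_empty (μ := m)]
    refine hlim _ _ MeasurableSet.empty (ae_of_all _ fun x => ?_)
    filter_upwards [eventually_lt_atBot x] with s hs
    exact iff_of_false (not_le.2 hs) (notMem_empty x)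
  have htop : Tendsto (fun s => m.real (Iic s)) atTop (𝓝 (μ.real A)) := by
    have h2 : m.real univ = μ.real A := by
      rw [Measure.real, hm, Measure.map_apply hfm MeasurableSet.univ, preimage_univ,
        Measure.restrict_apply_univ, Measure.real]
    rw [← h2]
    refine hlim _ _ MeasurableSet.univ (ae_of_all _ fun x => ?_)
    filter_upwards [eventually_ge_atTop x] with s hs
    exact iff_of_true hs (mem_univ x)
  obtain ⟨s₀, hs₀⟩ := (hbot.eventually_lt_const h0).exists
  obtain ⟨s₁, hs₁⟩ := (htop.eventually_const_lt h1).exists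
  obtain ⟨s, hs⟩ := mem_range_of_exists_le_of_exists_ge hcont ⟨s₀, hs₀.le⟩ ⟨s₁, hs₁.le⟩
  refine ⟨f ⁻¹' Iic s ∩ A, inter_subset_right, (hfm measurableSet_Iic).inter hA, fun g x => ?_, ?_⟩
  · simp [hfG, hAG]
  · rw [← hs]
    simp only [Measure.real, hmI]

namespace SimilarityIFS

variable {K : Type*} [MetricSpace K] [CompactSpace K] [MeasurableSpace K] [BorelSpace K] {N : ℕ}
  {S : SimilarityIFS K N} {ν : Fin N → ℝ≥0} {μ : Measure K}

omit [CompactSpace K] in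
theorem integral_eq_sum_integral_comp (hμ : IsSelfSimilarMeasure S ν μ) (m : ℕ) {f : K → ℝ}
    (hf : Measurable f) (hb : ∃ C, ∀ x, |f x| ≤ C) :
    ∫ x, f x ∂μ = ∑ w : Fin m → Fin N, (∏ i, (ν (w i) : ℝ)) * ∫ x, f (S.wordMap m w x) ∂μ := by
  have := hμ.isProbabilityMeasure
  induction m generalizing f with
  | zero => simp [wordMap]
  | succ m ih =>
    have hi : ∀ i : Fin N, Measurable (S.map i) := fun i => (S.continuous_map i).measurable
    have h1 : ∫ x, f x ∂μ = ∑ i, (ν i : ℝ) * ∫ x, f (S.map i x) ∂μ := by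
      conv_lhs => rw [hμ.self_similar]
      rw [integral_finsetSum_measure]
      · refine Finset.sum_congr rfl fun i _ => ?_
        rw [integral_smul_measure, integral_map (hi i).aemeasurable hf.aestronglyMeasurable]
        rfl
      · intro i _
        obtain ⟨C, hC⟩ := hb
        have := Measure.isProbabilityMeasure_map (μ := μ) (hi i).aemeasurable
        exact (Integrable.of_bound hf.aestronglyMeasurable C
          (ae_of_all _ hC)).smul_measure ENNReal.coe_ne_top
    rw [h1, sum_words_succ]
    refine Finset.sum_congr rfl fun i _ => ?_
    rw [ih (f := fun x => f (S.map i x)) (hf.comp (hi i)) (hb.imp fun C h x => h _),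
      Finset.mul_sum]
    refine Finset.sum_congr rfl fun w _ => ?_
    simp only [wordMap_cons, Fin.prod_univ_succ, Fin.cons_zero, Fin.cons_succ]
    ring

/-- A self-similar measure on a post-critically finite set with non-empty boundary does not charge
points: a point of maximal mass would lie in every cell. -/
theorem nullSingletonClass (hS : S.IsPCF) (hV : S.boundary.Nonempty)
    (hμ : IsSelfSimilarMeasure S ν μ) : NullSingletonClass μ := by
  have := hμ.isProbabilityMeasure
  refine ⟨fun a => ?_⟩
  by_contra ha
  obtain ⟨x₀, hx₀, hmax⟩ : ∃ x₀, 0 < μ.real {x₀} ∧ ∀ x, μ.real {x} ≤ μ.real {x₀} := by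
    have hfin : {x : K | μ {a} ≤ μ {x}}.Finite :=
      Measure.finite_const_le_meas_of_disjoint_iUnion μ (pos_iff_ne_zero.2 ha)
        (fun x => measurableSet_singleton x) (fun x y h => by simpa using h)
        (measure_ne_top _ _)
    obtain ⟨x₀, hx₀, h⟩ := Set.exists_max_image _ (fun x => μ {x}) hfin ⟨a, le_refl (μ {a})⟩
    refine ⟨x₀, ENNReal.toReal_pos ((pos_iff_ne_zero.2 ha).trans_le hx₀).ne' (measure_ne_top _ _),
      fun x => ENNReal.toReal_mono (measure_ne_top _ _) ?_⟩
    by_cases hx : μ {a} ≤ μ {x}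
    · exact h x hx
    · exact (not_le.1 hx).le.trans hx₀
  have hsum : ∀ x : K, μ.real {x} = ∑ i, (ν i : ℝ) * μ.real (S.map i ⁻¹' {x}) := by
    intro x
    have h := congrArg (fun m : Measure K => m {x}) hμ.self_similar
    simp only [Measure.coe_finsetSum, Finset.sum_apply, Measure.smul_apply, smul_eq_mul] at h
    rw [Measure.real, h, ENNReal.toReal_sum]
    · refine Finset.sum_congr rfl fun i _ => ?_
      rw [ENNReal.toReal_mul, Measure.map_apply (S.continuous_map i).measurable
        (measurableSet_singleton x)]
      rfl
    · intro i _
      rw [Measure.map_apply (S.continuous_map i).measurable (measurableSet_singleton x)]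
      exact ENNReal.mul_ne_top ENNReal.coe_ne_top (measure_ne_top _ _)
  have hpre : ∀ (i : Fin N) (x : K),
      S.map i ⁻¹' {x} = ∅ ∨ ∃ y, S.map i y = x ∧ S.map i ⁻¹' {x} = {y} := by
    intro i x
    by_cases h : ∃ y, S.map i y = x
    · obtain ⟨y, rfl⟩ := h
      refine Or.inr ⟨y, rfl, ?_⟩
      ext z
      simp [(S.map_injective i).eq_iff]
    · refine Or.inl (eq_empty_of_forall_notMem fun y hy => h ⟨y, hy⟩)
  -- The mass of `{x}` is a weighted average of masses at most the maximal one; equality forces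
  -- every preimage to exist and to have maximal mass.
  have hstep : ∀ x : K, μ.real {x} = μ.real {x₀} → ∀ i, ∃ y, S.map i y = x ∧
      μ.real {y} = μ.real {x₀} := by
    intro x hx i
    have hle : ∀ i ∈ Finset.univ, (ν i : ℝ) * μ.real (S.map i ⁻¹' {x})
        ≤ (ν i : ℝ) * μ.real {x₀} := by
      intro i _
      refine mul_le_mul_of_nonneg_left ?_ (NNReal.coe_nonneg _)
      rcases hpre i x with h | ⟨y, -, h⟩
      · rw [h, measureReal_empty]; exact hx₀.le
      · rw [h]; exact hmax y
    have heq := (Finset.sum_eq_sum_iff_of_le hle).1 (by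
      rw [← hsum, ← Finset.sum_mul, hx]
      have : (∑ i, (ν i : ℝ)) = 1 := by exact_mod_cast hμ.sum_weight
      rw [this, one_mul]) i (Finset.mem_univ i)
    have hνi : (ν i : ℝ) ≠ 0 := by exact_mod_cast (hμ.weight_pos i).ne'
    have heq' := mul_left_cancel₀ hνi heq
    rcases hpre i x with h | ⟨y, hy, h⟩
    · rw [h, measureReal_empty] at heq'
      exact absurd heq' hx₀.ne
    · exact ⟨y, hy, by rw [← heq', h]⟩
  have hcell : ∀ (m : ℕ) (w : Fin m → Fin N) (x : K), μ.real {x} = μ.real {x₀} →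
      x ∈ S.cell w := by
    intro m
    induction m with
    | zero => exact fun w x _ => ⟨x, rfl⟩
    | succ m ih =>
      intro w x hx
      obtain ⟨y, rfl, hy⟩ := hstep x hx (w 0)
      obtain ⟨z, hz⟩ := ih (fun i => w i.succ) y hy
      exact ⟨z, by rw [wordMap_succ, hz]⟩
  obtain ⟨i, j, hij⟩ := exists_ne_of_boundary_nonempty hV
  -- Every word is an address of `x₀`, which lies in two cells of level one, so every word is
  -- critical and every `τ` is a shift of one.
  have huniv : S.postCriticalSet = univ := by
    refine eq_univ_of_forall fun τ => ?_
    refine ⟨fun k => Nat.casesOn k i τ, ⟨x₀, fun m => hcell m _ _ rfl, i, j, hij, ?_⟩, 1, le_rfl,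
      rfl⟩
    obtain ⟨y, hy, -⟩ := hstep x₀ rfl i
    obtain ⟨z, hz, -⟩ := hstep x₀ rfl j
    exact ⟨⟨y, hy⟩, ⟨z, hz⟩⟩
  have : Nontrivial (Fin N) := ⟨i, j, hij⟩
  exact Set.infinite_univ (α := ℕ → Fin N) (huniv ▸ hS)

/-- Full symmetry forces equidistribution: over an invariant set, the mean value of a harmonic
function is the mean of its boundary values. -/
theorem IsHarmonic.setIntegral_of_invariant [ConnectedSpace K] {q : Fin 3 → K}
    {D : Matrix (Fin 3) (Fin 3) ℝ} {r : Fin N → ℝ} (hD : IsRegularHarmonicStructure S q D r)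
    {c : ℝ} (hc : 0 < c) (hDc : ∀ f j, (D *ᵥ f) j = c * (∑ k, f k - 3 * f j))
    (hqV : range q = S.boundary) [IsFiniteMeasure μ] {g : K ≃ₜ K}
    (hgq : ∀ i, g (q i) = q (finRotate 3 i))
    (hgE : ∀ u : K → ℝ, Continuous u → S.energy q D r (fun x => u (g x)) = S.energy q D r u)
    (hgμ : MeasurePreserving g μ μ) {E : Set K} (hE : ∀ x, g x ∈ E ↔ x ∈ E)
    {h : K → ℝ} (hh : S.IsHarmonic q D r h) :
    ∫ x in E, h x ∂μ = μ.real E * ((∑ k, h (q k)) / 3) := by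
  have hcomp : ∀ {u : K → ℝ}, S.IsHarmonic q D r u → S.IsHarmonic q D r (fun x => u (g x)) :=
    fun hu => hu.comp_of_energy_eq hD hc hDc hqV g.continuous hgE hgq
  have hint : ∀ u : K → ℝ, ∫ x in E, u (g x) ∂μ = ∫ x in E, u x ∂μ := by
    intro u
    have h1 := hgμ.setIntegral_preimage_emb g.measurableEmbedding u E
    rwa [show g ⁻¹' E = E from Set.ext hE] at h1
  have hI : ∀ {u : K → ℝ}, S.IsHarmonic q D r u → IntegrableOn u E μ := fun hu =>
    (hu.1.continuousOn.integrableOn_compact isCompact_univ).mono_set (subset_univ _)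
  have hconst : ∀ x, h x + h (g x) + h (g (g x)) = ∑ k, h (q k) := by
    refine IsHarmonic.eq_of_forall_eq hc hDc hD.pos hqV
      ((hh.add (hcomp hh)).add (hcomp (hcomp hh))) fun i => ?_
    simp only [hgq]
    rw [Fin.sum_univ_three]
    fin_cases i <;> simp <;> ring
  have key : ∫ x in E, (h x + h (g x) + h (g (g x))) ∂μ = 3 * ∫ x in E, h x ∂μ := by
    rw [integral_add (f := fun x => h x + h (g x)) (g := fun x => h (g (g x)))
        (hI (hh.add (hcomp hh))) (hI (hcomp (hcomp hh))),
      integral_add (hI hh) (hI (hcomp hh)), hint h, hint (fun x => h (g x)), hint h]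
    ring
  simp only [hconst] at key
  rw [setIntegral_const, smul_eq_mul] at key
  linarith

end SimilarityIFS

end PCF

/-! ### Barycentric weights and integrals over enlarged cells. -/

namespace PCF.SimilarityIFS

variable {K : Type*} [MetricSpace K] [CompactSpace K] {N : ℕ} {S : SimilarityIFS K N}
  {q : Fin 3 → K} {D : Matrix (Fin 3) (Fin 3) ℝ} {r : Fin N → ℝ} {c : ℝ}

variable (S q D r) in
/-- The space of harmonic functions, for a Laplacian `D` proportional to that of the complete
graph. -/
def harmonicSubmodule (hDc : ∀ f j, (D *ᵥ f) j = c * (∑ k, f k - 3 * f j)) :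
    Submodule ℝ (K → ℝ) where
  carrier := {h | S.IsHarmonic q D r h}
  add_mem' := fun ha hb => ha.add hb
  zero_mem' := isHarmonic_const hDc 0
  smul_mem' := fun a _ h => h.const_mul a

/-- The harmonic measure of a point: the value of a harmonic function is a fixed convex combination
of its boundary values. -/
theorem exists_barycentric [ConnectedSpace K] (hc : 0 < c)
    (hDc : ∀ f j, (D *ᵥ f) j = c * (∑ k, f k - 3 * f j)) (hr : ∀ i, 0 < r i)
    (hqV : range q = S.boundary) (x : K) :
    ∃ b : Fin 3 → ℝ, (∀ i, 0 ≤ b i) ∧ ∑ i, b i = 1 ∧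
      ∀ h, S.IsHarmonic q D r h → h x = ∑ i, b i * h (q i) := by
  set H := harmonicSubmodule S q D r hDc
  let R : H →ₗ[ℝ] (Fin 3 → ℝ) :=
    { toFun := fun h i => h.1 (q i)
      map_add' := fun _ _ => rfl
      map_smul' := fun _ _ => rfl }
  have hR : Function.Injective R := by
    refine (injective_iff_map_eq_zero R).2 fun h hh => Subtype.ext (funext fun y => ?_)
    exact IsHarmonic.eq_of_forall_eq hc hDc hr hqV h.2 (fun i => congrFun hh i) y
  let ev : H →ₗ[ℝ] ℝ :=
    { toFun := fun h => h.1 x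
      map_add' := fun _ _ => rfl
      map_smul' := fun _ _ => rfl }
  -- Evaluation at `x` as a functional of the boundary values, defined only on those that extend
  -- harmonically. It is dominated by the maximum, and Hahn–Banach extends it without a solution of
  -- the Dirichlet problem.
  let φ : (Fin 3 → ℝ) →ₗ.[ℝ] ℝ :=
    ⟨LinearMap.range R, ev.comp (LinearEquiv.ofInjective R hR).symm.toLinearMap⟩
  have hφ : ∀ h : H, φ ⟨R h, LinearMap.mem_range_self R h⟩ = h.1 x := by
    intro h
    change ev ((LinearEquiv.ofInjective R hR).symm ⟨R h, LinearMap.mem_range_self R h⟩) = _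
    have : (⟨R h, LinearMap.mem_range_self R h⟩ : LinearMap.range R)
      = LinearEquiv.ofInjective R hR h := rfl
    rw [this, LinearEquiv.symm_apply_apply]
    rfl
  have hbdd : ∀ f : Fin 3 → ℝ, BddAbove (range f) := fun f => Set.finite_range f |>.bddAbove
  obtain ⟨g, hg, hgN⟩ := exists_extension_of_le_sublinear φ (fun f => ⨆ i, f i)
    (fun a ha f => by
      rw [Real.mul_iSup_of_nonneg ha.le]
      rfl)
    (fun f f' => ciSup_le fun i => add_le_add (le_ciSup (hbdd f) i) (le_ciSup (hbdd f') i))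
    (by
      rintro ⟨_, h, rfl⟩
      rw [hφ h]
      exact IsHarmonic.le_of_forall_le hc hDc hr hqV h.2 (fun i => le_ciSup (hbdd (R h)) i) x)
  have hval : ∀ h, S.IsHarmonic q D r h → h x = ∑ i, g (Pi.single i 1) * h (q i) := by
    intro h hh
    have h1 : h x = g fun i => h (q i) := ((hg _).trans (hφ ⟨h, hh⟩)).symm
    rw [h1, LinearMap.pi_apply_eq_sum_univ g]
    refine Finset.sum_congr rfl fun i _ => ?_
    rw [smul_eq_mul, mul_comm]
    congr 2
    funext j
    simp [Pi.single_apply, eq_comm]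
  refine ⟨fun i => g (Pi.single i 1), fun i => ?_, ?_, hval⟩
  · have h1 : g (-Pi.single i 1) ≤ 0 := (hgN _).trans (ciSup_le fun j => by
      by_cases hij : j = i <;> simp [hij])
    rw [map_neg] at h1
    linarith
  · have := hval _ (isHarmonic_const hDc 1)
    simpa using this.symm

open Classical in
omit [CompactSpace K] in
/-- At a vertex away from the boundary, the means of a harmonic function over the vertices of the
adjacent cells average to its value. -/
theorem IsHarmonic.sum_adjacent_cells (hc : 0 < c)
    (hDc : ∀ f j, (D *ᵥ f) j = c * (∑ k, f k - 3 * f j)) (hr : ∀ i, 0 < r i)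
    (hrr : ∀ i j, r i = r j) (hq : Function.Injective q) (hqV : range q = S.boundary)
    {h : K → ℝ} (hh : S.IsHarmonic q D r h) {m : ℕ} (w : Fin m → Fin N) (i : Fin 3)
    (hp : S.wordMap m w (q i) ∉ S.boundary) :
    ∑ v : Fin m → Fin N, (if S.wordMap m w (q i) ∈ S.cell v then
        (∑ k, h (S.wordMap m v (q k))) / 3 else 0)
      = (∑ v : Fin m → Fin N, if S.wordMap m w (q i) ∈ S.cell v then 1 else 0)
        * h (S.wordMap m w (q i)) := by
  set p := S.wordMap m w (q i)
  have hprod : ∀ v : Fin m → Fin N, (∏ k, r (v k))⁻¹ = (∏ k, r (w k))⁻¹ := fun v => by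
    congr 1
    exact Finset.prod_congr rfl fun k _ => hrr _ _
  set R := (∏ k, r (w k))⁻¹
  have hR : 0 < R := inv_pos.2 (Finset.prod_pos fun _ _ => hr _)
  -- `D f` at `j` is `3c` times the mean of `f` minus `f j`, and each cell containing `p` has it as
  -- exactly one vertex.
  have key : ∀ v : Fin m → Fin N, (∑ j : Fin 3, if S.wordMap m v (q j) = p then
      (∏ k, r (v k))⁻¹ * (D *ᵥ fun k => h (S.wordMap m v (q k))) j else 0)
      = (3 * R * c) * ((if p ∈ S.cell v then (∑ k, h (S.wordMap m v (q k))) / 3 else 0)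
        - (if p ∈ S.cell v then 1 else 0) * h p) := by
    intro v
    by_cases hv : p ∈ S.cell v
    · obtain ⟨j, hj⟩ : ∃ j, S.wordMap m v (q j) = p := by
        by_cases hvw : v = w
        · exact ⟨i, by rw [hvw]⟩
        · exact exists_wordMap_eq_of_mem_cell hqV hvw hv ⟨_, rfl⟩
      rw [if_pos hv, if_pos hv, Finset.sum_eq_single_of_mem j (Finset.mem_univ j), if_pos hj,
        hDc, hj, hprod]
      · ring
      · intro j' _ hj'
        exact if_neg fun h' => hj' (hq (S.wordMap_injective v (h'.trans hj.symm)))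
    · rw [if_neg hv, if_neg hv]
      rw [Finset.sum_eq_zero fun j _ => if_neg fun h' => hv ⟨_, h'⟩]
      ring
  have h1 := hh.2 m w i hp
  rw [graphLaplacian, Finset.sum_congr rfl fun v _ => key v, ← Finset.mul_sum,
    Finset.sum_sub_distrib, ← Finset.sum_mul] at h1
  have h2 : 3 * R * c ≠ 0 := by positivity
  exact sub_eq_zero.1 ((mul_eq_zero.1 h1).resolve_left h2)

variable (S q) in
/-- The cell `C_w` enlarged, within the cells that contain its `i`-th vertex, by the copies of the
set `E i`. -/
def enlargedCell {m : ℕ} (w : Fin m → Fin N) (E : Fin 3 → Set K) : Set K :=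
  S.cell w ∪ ⋃ v : Fin m → Fin N, S.wordMap m v '' ⋃ i ∈ {i | S.wordMap m w (q i) ∈ S.cell v}, E i

omit [CompactSpace K] in
theorem enlargedCell_subset {m : ℕ} (w : Fin m → Fin N) (E : Fin 3 → Set K) :
    S.enlargedCell q w E ⊆ S.cellNbhd w := by
  refine union_subset (fun x hx => mem_iUnion₂.2 ⟨w, ⟨x, hx, hx⟩, hx⟩) (iUnion_subset fun v => ?_)
  rintro _ ⟨y, hy, rfl⟩
  obtain ⟨i, hi, -⟩ := mem_iUnion₂.1 hy
  exact mem_iUnion₂.2 ⟨v, ⟨_, hi, ⟨_, rfl⟩⟩, ⟨_, rfl⟩⟩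

variable [MeasurableSpace K] [BorelSpace K] {ν : Fin N → ℝ≥0} {μ : Measure K}

theorem measurableSet_enlargedCell {m : ℕ} (w : Fin m → Fin N) {E : Fin 3 → Set K}
    (hE : ∀ i, MeasurableSet (E i)) : MeasurableSet (S.enlargedCell q w E) := by
  refine (S.isClosed_cell w).measurableSet.union (MeasurableSet.iUnion fun v => ?_)
  refine ((S.continuous_wordMap v).isClosedEmbedding
    (S.wordMap_injective v)).measurableEmbedding.measurableSet_image.2 ?_
  exact Set.Finite.measurableSet_biUnion (Set.toFinite _) fun i _ => hE i

omit [CompactSpace K] [MeasurableSpace K] [BorelSpace K] in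
theorem preimage_enlargedCell_self {m : ℕ} (w : Fin m → Fin N) (E : Fin 3 → Set K) :
    S.wordMap m w ⁻¹' S.enlargedCell q w E = univ :=
  eq_univ_of_forall fun _ => Or.inl ⟨_, rfl⟩

omit [CompactSpace K] [BorelSpace K] in
-- Distinct cells overlap only in images of `V_0`, which is countable and so null; almost everywhere
-- in `C_v` only the pieces copied by `v` itself count.
theorem preimage_enlargedCell_ae_eq [NullSingletonClass μ] (hqV : range q = S.boundary) {m : ℕ}
    {v w : Fin m → Fin N} (hvw : v ≠ w) (E : Fin 3 → Set K) :
    S.wordMap m v ⁻¹' S.enlargedCell q w E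
      =ᵐ[μ] ⋃ i ∈ {i | S.wordMap m w (q i) ∈ S.cell v}, E i := by
  have hV : S.boundary.Countable := hqV ▸ (Set.finite_range q).countable
  filter_upwards [hV.ae_notMem μ] with x hx
  refine propext ⟨?_, fun h => Or.inr (mem_iUnion.2 ⟨v, x, h, rfl⟩)⟩
  rintro (⟨y, hy⟩ | h)
  · exact absurd (mem_boundary_of_wordMap_eq hvw hy.symm) hx
  · obtain ⟨u, y, hy, hyx⟩ := mem_iUnion.1 h
    by_cases huv : v = u
    · subst huv
      rwa [← S.wordMap_injective v hyx]
    · exact absurd (mem_boundary_of_wordMap_eq huv hyx.symm) hx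

open Classical in
theorem IsHarmonic.setIntegral_enlargedCell [NullSingletonClass μ]
    (hμ : IsSelfSimilarMeasure S ν μ) (hν : ∀ i j, ν i = ν j) (hc : 0 < c)
    (hDc : ∀ f j, (D *ᵥ f) j = c * (∑ k, f k - 3 * f j)) (hr : ∀ i, 0 < r i)
    (hrr : ∀ i j, r i = r j) (hq : Function.Injective q) (hqV : range q = S.boundary)
    {m : ℕ} (w : Fin m → Fin N) (hw : Disjoint (S.cell w) S.boundary)
    {E : Fin 3 → Set K} (hE : ∀ i, MeasurableSet (E i)) (hEd : Pairwise (Function.onFun Disjoint E))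
    (hEI : ∀ i u, S.IsHarmonic q D r u →
      ∫ x in E i, u x ∂μ = μ.real (E i) * ((∑ k, u (q k)) / 3))
    (huniv : ∀ u, S.IsHarmonic q D r u → ∫ x, u x ∂μ = (∑ k, u (q k)) / 3)
    {h : K → ℝ} (hh : S.IsHarmonic q D r h) :
    ∫ x in S.enlargedCell q w E, h x ∂μ = (∏ i, (ν (w i) : ℝ)) *
      ((1 - ∑ i, μ.real (E i)) * ((∑ k, h (S.wordMap m w (q k))) / 3)
        + ∑ i, μ.real (E i) * ((∑ v : Fin m → Fin N,
          if S.wordMap m w (q i) ∈ S.cell v then 1 else 0) * h (S.wordMap m w (q i)))) := by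
  have := hμ.isProbabilityMeasure
  have hB := measurableSet_enlargedCell (S := S) (q := q) w hE
  obtain ⟨C, hC⟩ : ∃ C, ∀ x, |h x| ≤ C := by
    obtain ⟨C, hC⟩ := isCompact_univ.exists_bound_of_continuousOn hh.1.continuousOn
    exact ⟨C, fun x => hC x (mem_univ x)⟩
  have hprod : ∀ v : Fin m → Fin N, (∏ k, (ν (v k) : ℝ)) = ∏ k, (ν (w k) : ℝ) := fun v =>
    Finset.prod_congr rfl fun k _ => by rw [hν]
  set A : (Fin m → Fin N) → ℝ := fun v => (∑ k, h (S.wordMap m v (q k))) / 3 with hA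
  -- In `C_w` the copies of the `E i` add nothing. Counting them there as in any other cell, and
  -- correcting by `1 - ∑ i, μ.real (E i)`, lets the sum over `v` run over all cells at a vertex.
  have hterm : ∀ v : Fin m → Fin N,
      ∫ x, (S.enlargedCell q w E).indicator h (S.wordMap m v x) ∂μ
        = (∑ i, μ.real (E i) * if S.wordMap m w (q i) ∈ S.cell v then A v else 0)
          + if v = w then (1 - ∑ i, μ.real (E i)) * A w else 0 := by
    intro v
    have hv := hh.comp_wordMap hr v
    have h1 : ∫ x, (S.enlargedCell q w E).indicator h (S.wordMap m v x) ∂μ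
        = ∫ x in S.wordMap m v ⁻¹' S.enlargedCell q w E, h (S.wordMap m v x) ∂μ := by
      rw [← integral_indicator (hB.preimage (S.continuous_wordMap v).measurable)]
      rfl
    rw [h1]
    by_cases hvw : v = w
    · subst hvw
      rw [preimage_enlargedCell_self, setIntegral_univ, huniv _ hv, if_pos rfl]
      have : ∀ i, S.wordMap m v (q i) ∈ S.cell v := fun i => ⟨_, rfl⟩
      simp only [this, if_true]
      rw [← Finset.sum_mul]
      ring
    · rw [setIntegral_congr_set (preimage_enlargedCell_ae_eq hqV hvw E), if_neg hvw, add_zero]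
      have h2 : (⋃ i ∈ {i | S.wordMap m w (q i) ∈ S.cell v}, E i)
          = ⋃ i ∈ Finset.univ.filter (fun i => S.wordMap m w (q i) ∈ S.cell v), E i := by
        simp
      rw [h2, integral_biUnion_finset]
      · rw [Finset.sum_filter]
        refine Finset.sum_congr rfl fun i _ => ?_
        rw [hEI i _ hv, mul_ite, mul_zero]
      · exact fun i _ => hE i
      · exact fun i _ j _ hij => hEd hij
      · exact fun i _ =>
          (hv.1.continuousOn.integrableOn_compact isCompact_univ).mono_set (subset_univ _)
  rw [← integral_indicator hB, integral_eq_sum_integral_comp hμ m (hh.1.measurable.indicator hB)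
    ⟨C, fun x => ?_⟩]
  · simp only [hterm, hprod]
    rw [← Finset.mul_sum, Finset.sum_add_distrib, Finset.sum_comm, Finset.sum_ite_eq',
      if_pos (Finset.mem_univ w), add_comm]
    congr 2
    refine Finset.sum_congr rfl fun i _ => ?_
    rw [← Finset.mul_sum, hA, hh.sum_adjacent_cells hc hDc hr hrr hq hqV w i]
    exact fun hb => Set.disjoint_left.1 hw ⟨_, rfl⟩ hb
  · by_cases hx : x ∈ S.enlargedCell q w E
    · rw [indicator_of_mem hx]; exact hC x
    · rw [indicator_of_notMem hx, abs_zero]; exact (abs_nonneg _).trans (hC x)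

/-- The weights with which the neighbours of a cell have to be added in order to move the mean value
point to a given point of the simplex. -/
theorem exists_weights {b M : Fin 3 → ℝ} (hb : ∀ i, 0 ≤ b i) (hb1 : ∑ i, b i = 1)
    (hM : ∀ i, 1 ≤ M i) : ∃ (e : Fin 3 → ℝ) (T : ℝ), 0 < T ∧ (∀ i, 0 ≤ e i) ∧ ∑ i, e i ≤ 1 ∧
      ∀ f : Fin 3 → ℝ, (1 - ∑ i, e i) * ((∑ k, f k) / 3) + ∑ i, e i * (M i * f i)
        = T * ∑ i, b i * f i := by
  obtain ⟨k, hk⟩ := Finite.exists_min b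
  have hM0 : ∀ i, 0 < M i := fun i => one_pos.trans_le (hM i)
  -- Comparing coefficients of `f i` gives `(1 - ∑ e) / 3 + e i * M i = T * b i`. Setting `e k = 0`
  -- at the smallest weight yields `e i = T * (b i - b k) / M i` and `T = Δ⁻¹`.
  have hd : ∀ i, 0 ≤ (b i - b k) / M i := fun i => div_nonneg (sub_nonneg.2 (hk i)) (hM0 i).le
  set Δ := 3 * b k + ∑ i, (b i - b k) / M i with hΔ
  have hΔ0 : 0 < Δ := by
    rcases (hb k).eq_or_lt with h0 | h0
    · obtain ⟨i, hi⟩ : ∃ i, 0 < b i := by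
        by_contra! hcon
        have := Finset.sum_nonpos fun i (_ : i ∈ Finset.univ) => hcon i
        linarith
      have : 0 < ∑ i, (b i - b k) / M i := Finset.sum_pos' (fun i _ => hd i)
        ⟨i, Finset.mem_univ i, div_pos (by linarith) (hM0 i)⟩
      linarith
    · have := Finset.sum_nonneg fun i (_ : i ∈ Finset.univ) => hd i
      linarith
  have hsum : ∑ i, Δ⁻¹ * ((b i - b k) / M i) = 1 - Δ⁻¹ * (3 * b k) := by
    rw [← Finset.mul_sum, show ∑ i, (b i - b k) / M i = Δ - 3 * b k by rw [hΔ]; ring, mul_sub,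
      inv_mul_cancel₀ hΔ0.ne']
  refine ⟨fun i => Δ⁻¹ * ((b i - b k) / M i), Δ⁻¹, inv_pos.2 hΔ0,
    fun i => mul_nonneg (inv_pos.2 hΔ0).le (hd i), ?_, fun f => ?_⟩
  · rw [hsum]
    have := mul_nonneg (inv_pos.2 hΔ0).le (mul_nonneg zero_le_three (hb k))
    linarith
  · have : ∀ i, Δ⁻¹ * ((b i - b k) / M i) * (M i * f i) = Δ⁻¹ * (b i * f i - b k * f i) := by
      intro i
      have := (hM0 i).ne'
      field_simp
    simp only [hsum, this]
    rw [← Finset.mul_sum, Finset.sum_sub_distrib, ← Finset.mul_sum]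
    ring

end PCF.SimilarityIFS

/-! ### Construction of the mean value neighbourhoods. -/

namespace PCF

theorem exists_pairwise_disjoint_invariant {K : Type*} [MeasurableSpace K]
    [StandardBorelSpace K] {G : Type*} [Group G] [Finite G] [MulAction G K]
    (hG : ∀ g : G, Measurable fun x : K => g • x) (μ : Measure K) [IsProbabilityMeasure μ]
    [NullSingletonClass μ] {e : Fin 3 → ℝ} (he : ∀ i, 0 ≤ e i) (he1 : ∑ i, e i ≤ 1) :
    ∃ E : Fin 3 → Set K, (∀ i, MeasurableSet (E i)) ∧ Pairwise (Function.onFun Disjoint E) ∧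
      (∀ i (g : G) (x : K), g • x ∈ E i ↔ x ∈ E i) ∧ ∀ i, μ.real (E i) = e i := by
  rw [Fin.sum_univ_three] at he1
  have h0 := he 0
  have h1 := he 1
  have h2 := he 2
  obtain ⟨E₀, -, hm₀, hG₀, hμ₀⟩ := exists_invariant_subset_measureReal_eq hG μ
    MeasurableSet.univ (fun _ _ => Iff.rfl) (he 0) (by rw [probReal_univ]; linarith)
  obtain ⟨E₁, hs₁, hm₁, hG₁, hμ₁⟩ := exists_invariant_subset_measureReal_eq hG μ
    hm₀.compl (fun g x => not_congr (hG₀ g x)) (he 1)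
    (by rw [probReal_compl_eq_one_sub hm₀]; linarith)
  have hd₁ : Disjoint E₀ E₁ := (disjoint_compl_right.mono_right hs₁)
  obtain ⟨E₂, hs₂, hm₂, hG₂, hμ₂⟩ := exists_invariant_subset_measureReal_eq hG μ
    (hm₀.union hm₁).compl (fun g x => not_congr (or_congr (hG₀ g x) (hG₁ g x))) (he 2)
    (by rw [probReal_compl_eq_one_sub (hm₀.union hm₁), measureReal_union hd₁ hm₁]; linarith)
  have hd₂ : Disjoint (E₀ ∪ E₁) E₂ := (disjoint_compl_right.mono_right hs₂)
  rw [disjoint_union_left] at hd₂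
  refine ⟨![E₀, E₁, E₂], ?_, ?_, ?_, ?_⟩
  · intro i; fin_cases i <;> assumption
  · intro i j hij
    fin_cases i <;> fin_cases j <;>
      first
      | exact absurd rfl hij
      | exact hd₁
      | exact hd₁.symm
      | exact hd₂.1
      | exact hd₂.1.symm
      | exact hd₂.2
      | exact hd₂.2.symm
  · intro i; fin_cases i <;> assumption
  · intro i; fin_cases i <;> assumption

namespace SimilarityIFS

variable {K : Type*} [MetricSpace K] [CompactSpace K] [ConnectedSpace K] [MeasurableSpace K]
  [BorelSpace K] {N : ℕ} {S : SimilarityIFS K N} {q : Fin 3 → K}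
  {D : Matrix (Fin 3) (Fin 3) ℝ} {r : Fin N → ℝ} {ν : Fin N → ℝ≥0} {μ : Measure K}

theorem exists_isMeanValueNbhd (hS : S.IsPCF) (hq : Function.Injective q)
    (hqV : range q = S.boundary) (hD : IsRegularHarmonicStructure S q D r)
    (hμ : IsSelfSimilarMeasure S ν μ) (hsymm : HasFullD3Symmetry S q D r μ)
    (hr : ∀ i j, r i = r j) (hν : ∀ i j, ν i = ν j) {m : ℕ} (w : Fin m → Fin N) {x : K}
    (hx : x ∈ S.cell w) (hw : Disjoint (S.cell w) S.boundary) :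
    ∃ B : Set K, IsMeanValueNbhd S q D r μ x w B := by
  classical
  obtain ⟨G, ⟨φ⟩, hG, hGσ⟩ := hsymm
  -- Every permutation is realized by a symmetry, and injectivity of `q` identifies it with the one
  -- that preserves `D`.
  obtain ⟨c, hc, hDc⟩ := hD.isLaplacian.exists_mulVec_eq fun σ i j => by
    obtain ⟨g, hg, hgq⟩ := hGσ σ
    obtain ⟨⟨σ', hσ', hDσ'⟩, -⟩ := hG g hg
    have : σ' = σ := Equiv.ext fun i => hq ((hσ' i).symm.trans (hgq i))
    rw [← this, hDσ']
  obtain ⟨g, hgG, hgq⟩ := hGσ (finRotate 3)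
  obtain ⟨-, hgE, hgμ⟩ := hG g hgG
  have := hμ.isProbabilityMeasure
  have : NullSingletonClass μ := nullSingletonClass hS ⟨_, apply_mem_boundary hqV 0⟩ hμ
  have hmean : ∀ {E : Set K}, (∀ x, g x ∈ E ↔ x ∈ E) → ∀ u, S.IsHarmonic q D r u →
      ∫ x in E, u x ∂μ = μ.real E * ((∑ k, u (q k)) / 3) := fun hE u hu =>
    hu.setIntegral_of_invariant hD hc hDc hqV hgq hgE hgμ hE
  have huniv : ∀ u, S.IsHarmonic q D r u → ∫ x, u x ∂μ = (∑ k, u (q k)) / 3 := by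
    intro u hu
    rw [← setIntegral_univ, hmean (fun _ => Iff.rfl) u hu, probReal_univ, one_mul]
  set M : Fin 3 → ℝ := fun i =>
    ∑ v : Fin m → Fin N, if S.wordMap m w (q i) ∈ S.cell v then 1 else 0 with hMdef
  have hM : ∀ i, 1 ≤ M i := by
    intro i
    have h1 := Finset.single_le_sum (f := fun v : Fin m → Fin N =>
      if S.wordMap m w (q i) ∈ S.cell v then (1 : ℝ) else 0)
      (fun v _ => by split_ifs <;> norm_num) (Finset.mem_univ w)
    simpa only [show S.wordMap m w (q i) ∈ S.cell w from ⟨_, rfl⟩, if_true] using h1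
  have main : ∀ (E : Fin 3 → Set K) (T : ℝ), (∀ i, MeasurableSet (E i)) →
      Pairwise (Function.onFun Disjoint E) → (∀ i x, g x ∈ E i ↔ x ∈ E i) →
      0 < T → S.enlargedCell q w E ∈ 𝓝 x →
      (∀ u, S.IsHarmonic q D r u →
        (1 - ∑ i, μ.real (E i)) * ((∑ k, u (S.wordMap m w (q k))) / 3)
          + ∑ i, μ.real (E i) * (M i * u (S.wordMap m w (q i))) = T * u x) →
      IsMeanValueNbhd S q D r μ x w (S.enlargedCell q w E) := by
    intro E T hEm hEd hEg hT hnhds hval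
    have hint : ∀ u, S.IsHarmonic q D r u → ∫ y in S.enlargedCell q w E, u y ∂μ
        = (∏ i, (ν (w i) : ℝ)) * T * u x := by
      intro u hu
      rw [hu.setIntegral_enlargedCell hμ hν hc hDc hD.pos hr hq hqV w hw hEm hEd
        (fun i => hmean (hEg i)) huniv, hval u hu, mul_assoc]
    have hν0 : 0 < ∏ i, (ν (w i) : ℝ) :=
      Finset.prod_pos fun i _ => by exact_mod_cast hμ.weight_pos (w i)
    have hB := hint _ (isHarmonic_const hDc 1)
    rw [setIntegral_const, smul_eq_mul, mul_one, mul_one] at hB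
    refine ⟨measurableSet_enlargedCell w hEm, hnhds, subset_union_left,
      enlargedCell_subset w E, fun h hh => ?_⟩
    rw [setAverage_eq, hint h hh, hB, smul_eq_mul, inv_mul_cancel_left₀ (mul_pos hν0 hT).ne']
  by_cases hvert : ∃ i, S.wordMap m w (q i) = x
  · obtain ⟨i, rfl⟩ := hvert
    have hE : ∀ j, μ.real (Function.update (fun _ => (∅ : Set K)) i univ j)
        = if j = i then 1 else 0 := by
      intro j
      by_cases hj : j = i
      · subst hj; simp
      · simp [hj]
    -- With `E i = K` and the other sets empty, the enlarged cell is the union of all cells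
    -- containing the vertex.
    refine ⟨_, main (Function.update (fun _ => ∅) i univ) (M i) (fun j => ?_) (fun j k hjk => ?_)
      (fun j y => ?_) (one_pos.trans_le (hM i)) ?_ fun u _ => ?_⟩
    · by_cases hj : j = i
      · subst hj; simp
      · simp [hj]
    · by_cases hj : j = i
      · subst hj; simp [Function.onFun, hjk.symm]
      · simp [Function.onFun, hj]
    · by_cases hj : j = i
      · subst hj; simp
      · simp [hj]
    · refine mem_of_superset (biUnion_cell_mem_nhds (S := S) m _) (iUnion₂_subset fun v hv => ?_)
      rintro _ ⟨y, rfl⟩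
      exact Or.inr (mem_iUnion.2 ⟨v, y, mem_iUnion₂.2 ⟨i, hv, by simp⟩, rfl⟩)
    · simp [hE]
  · obtain ⟨y, rfl⟩ := hx
    obtain ⟨b, hb, hb1, hbu⟩ := exists_barycentric hc hDc hD.pos hqV y
    obtain ⟨e, T, hT, he, he1, heq⟩ := exists_weights hb hb1 hM
    let _ : MulAction G K :=
      { smul := fun g x => g.1 x
        one_smul := fun _ => rfl
        mul_smul := fun _ _ _ => rfl }
    have : Finite G := Finite.of_equiv _ φ.symm.toEquiv
    obtain ⟨E, hEm, hEd, hEG, hEe⟩ := exists_pairwise_disjoint_invariant (G := G)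
      (fun g => g.1.continuous.measurable) μ he he1
    refine ⟨_, main E T hEm hEd (fun i z => hEG i ⟨g, hgG⟩ z) hT ?_ fun u hu => ?_⟩
    · refine mem_of_superset (biUnion_cell_mem_nhds (S := S) m _) (iUnion₂_subset fun v hv => ?_)
      by_cases hvw : v = w
      · rw [hvw]; exact subset_union_left
      · exact absurd (exists_wordMap_eq_of_mem_cell hqV (Ne.symm hvw) ⟨y, rfl⟩ hv) hvert
    · simp only [hEe]
      rw [heq fun i => u (S.wordMap m w (q i)), hbu _ (hu.comp_wordMap hD.pos w)]

omit [ConnectedSpace K] [MeasurableSpace K] [BorelSpace K] in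
theorem exists_mem_cell_disjoint_boundary (hqV : range q = S.boundary) {x : K}
    (hx : x ∉ S.boundary) : ∃ k₀ : ℕ, ∀ k, k₀ ≤ k → ∃ w : Fin k → Fin N,
      x ∈ S.cell w ∧ Disjoint (S.cell w) S.boundary := by
  have hcl : IsClosed S.boundary := hqV ▸ (Set.finite_range q).isClosed
  obtain ⟨ε, hε, hball⟩ := Metric.mem_nhds_iff.1 (hcl.isOpen_compl.mem_nhds hx)
  obtain ⟨n, hn⟩ := S.exists_dist_le_of_mem_cell hε
  refine ⟨n, fun k hk => ?_⟩
  obtain ⟨w, hw⟩ := S.exists_mem_cell k x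
  exact ⟨w, hw, Set.disjoint_left.2 fun y hy => hball (hn k hk w y hy x hw)⟩

omit [ConnectedSpace K] [MeasurableSpace K] [BorelSpace K] in
theorem exists_cellNbhd_subset {x : K} {t : Set K} (ht : t ∈ 𝓝 x) :
    ∃ n : ℕ, ∀ k, n ≤ k → ∀ w : Fin k → Fin N, x ∈ S.cell w → S.cellNbhd w ⊆ t := by
  obtain ⟨ε, hε, hball⟩ := Metric.mem_nhds_iff.1 ht
  obtain ⟨n, hn⟩ := S.exists_dist_le_of_mem_cell (half_pos hε)
  refine ⟨n, fun k hk w hw y hy => hball ?_⟩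
  obtain ⟨v, ⟨z, hzv, hzw⟩, hyv⟩ := mem_iUnion₂.1 hy
  have h1 := hn k hk v y hyv z hzv
  have h2 := hn k hk w z hzw x hw
  rw [Metric.mem_ball]
  linarith [dist_triangle y z x]

end SimilarityIFS

end PCF

theorem theorem5p1 {K : Type*} [MetricSpace K] [CompactSpace K] [ConnectedSpace K]
    [MeasurableSpace K] [BorelSpace K] {N : ℕ} (S : PCF.SimilarityIFS K N) (hS : S.IsPCF)
    (q : Fin 3 → K) (hq : Function.Injective q) (hqV : Set.range q = S.boundary)
    (D : Matrix (Fin 3) (Fin 3) ℝ) (r : Fin N → ℝ)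
    (hD : PCF.IsRegularHarmonicStructure S q D r)
    (ν : Fin N → ℝ≥0) (μ : Measure K) (hμ : PCF.IsSelfSimilarMeasure S ν μ)
    (hsymm : PCF.HasFullD3Symmetry S q D r μ)
    (hr : ∀ i j, r i = r j) (hν : ∀ i j, ν i = ν j) :
    (∀ (m : ℕ) (w : Fin m → Fin N) (x : K), x ∈ S.cell w → Disjoint (S.cell w) S.boundary →
      ∃ B : Set K, PCF.IsMeanValueNbhd S q D r μ x w B) ∧
    (∀ x : K, x ∉ S.boundary →
      ∃ (k₀ : ℕ) (w : (k : ℕ) → Fin k → Fin N) (B : ℕ → Set K),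
        (∀ k, k₀ ≤ k → x ∈ S.cell (w k) ∧ Disjoint (S.cell (w k)) S.boundary ∧
          PCF.IsMeanValueNbhd S q D r μ x (w k) (B k)) ∧
        (𝓝 x).HasBasis (fun k => k₀ ≤ k) B ∧
        ⋂ (k : ℕ) (_ : k₀ ≤ k), B k = {x}) := by
  have ha : ∀ (m : ℕ) (w : Fin m → Fin N) (x : K), x ∈ S.cell w →
      Disjoint (S.cell w) S.boundary → ∃ B : Set K, PCF.IsMeanValueNbhd S q D r μ x w B :=
    fun m w x hx hw => PCF.SimilarityIFS.exists_isMeanValueNbhd hS hq hqV hD hμ hsymm hr hν w hx hw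
  refine ⟨ha, fun x hx => ?_⟩
  obtain ⟨k₀, hk₀⟩ := PCF.SimilarityIFS.exists_mem_cell_disjoint_boundary hqV hx
  choose w hw using fun k => S.exists_mem_cell k x
  have hex : ∀ k, ∃ (v : Fin k → Fin N) (B : Set K), k₀ ≤ k → x ∈ S.cell v ∧
      Disjoint (S.cell v) S.boundary ∧ PCF.IsMeanValueNbhd S q D r μ x v B := by
    intro k
    by_cases hk : k₀ ≤ k
    · obtain ⟨v, hv, hvd⟩ := hk₀ k hk
      obtain ⟨B, hB⟩ := ha k v x hv hvd
      exact ⟨v, B, fun _ => ⟨hv, hvd, hB⟩⟩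
    -- Below `k₀` the word and the set are placeholders.
    · exact ⟨w k, univ, fun h => absurd h hk⟩
  choose v B hvB using hex
  have hbasis : (𝓝 x).HasBasis (fun k => k₀ ≤ k) B := by
    refine ⟨fun t => ⟨fun ht => ?_, ?_⟩⟩
    · obtain ⟨n, hn⟩ := PCF.SimilarityIFS.exists_cellNbhd_subset (S := S) ht
      have hk := le_max_left k₀ n
      obtain ⟨h1, -, h2⟩ := hvB _ hk
      exact ⟨_, hk, h2.subset_cellNbhd.trans (hn _ (le_max_right _ _) _ h1)⟩
    · rintro ⟨k, hk, hkt⟩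
      exact mem_of_superset (hvB k hk).2.2.mem_nhds hkt
  refine ⟨k₀, v, B, hvB, hbasis, ?_⟩
  refine Subset.antisymm (fun y hy => ?_) ?_
  · by_contra hne
    have hnhds : ({y}ᶜ : Set K) ∈ 𝓝 x := compl_singleton_mem_nhds (Ne.symm hne)
    obtain ⟨k, hk, hkt⟩ := hbasis.mem_iff.1 hnhds
    exact hkt (mem_iInter₂.1 hy k hk) rfl
  · rintro _ rfl
    exact mem_iInter₂.2 fun k hk => mem_of_mem_nhds (hvB k hk).2.2.mem_nhds
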